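/- Let $\mathbb{U}^*=\{\zeta\in\mathbb{C}:|\zeta|>1\}$, and let $\Sigma$ be the class of all functions $f$ that are meromorphic in $\mathbb{U}^*$ and have near $\infty$ an expansion $$f(\zeta)=b\zeta+b_0+\frac{b_1}{\zeta}+\frac{b_2}{\zeta^2}+\cdots\qquad(b,b_0,b_1,\ldots\in\mathbb{C}).$$ A meromorphic function is called univalent in a set if it is injective there as a map into the Riemann sphere $\mathbb{C}\cup\{\infty\}$, and locally univalent in $\mathbb{U}^*$ if every point of $\mathbb{U}^*$ has a neighbourhood in which it is univalent. Let $$S_f=\left(\frac{f''}{f'}\right)'-\frac12\left(\frac{f''}{f'}\right)^2$$ denote the Schwarzian derivative of $f$. Let $f,g\in\Sigma$ be locally univalent in $\mathbb{U}^*$. If $$\left|\frac12\,(|\zeta|^2-1)^2\,\frac{\zeta}{\overline{\zeta}}\,\bigl(S_f(\zeta)-S_g(\zeta)\bigr)-(|\zeta|^2-1)\,\frac{\zeta g''(\zeta)}{g'(\zeta)}\right|\le 1$$ for all $\zeta\in\mathbb{U}^*$ at which neither $f$ nor $g$ has a pole, then $f$ is univalent in $\mathbb{U}^*$. -/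

import Mathlib

open Filter Topology Bornology

namespace ExteriorUnivalence

/-- The exterior `U*` of the closed unit disk in the complex plane. -/
def exteriorDisk : Set ℂ := {ζ : ℂ | 1 < ‖ζ‖}

/-- The class `Σ`: functions `f` meromorphic in `U*` (poles in `U*` are allowed) which near `∞` have
an expansion `f ζ = b * ζ + b₀ + b₁ / ζ + b₂ / ζ ^ 2 + …`; the convergent power series
`b₀ + b₁ * w + b₂ * w ^ 2 + …` is the germ at `0` of the analytic function `φ`.
Normal form (`MeromorphicNFOn`) only removes the ambiguity of the values of a meromorphic function:
`f` is analytic at each point of `U*` that is not a pole. Every meromorphic function on `U*` has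
exactly one representative of this kind on `U*`. -/
def ClassSigma (f : ℂ → ℂ) : Prop :=
  MeromorphicNFOn f exteriorDisk ∧
    ∃ (b : ℂ) (φ : ℂ → ℂ), AnalyticAt ℂ φ 0 ∧ ∀ᶠ ζ in cobounded ℂ, f ζ = b * ζ + φ ζ⁻¹

/-- The meromorphic function `f` as a map to the Riemann sphere: the value is `∞` at the poles. -/
noncomputable def sphereValue (f : ℂ → ℂ) (ζ : ℂ) : OnePoint ℂ :=
  open Classical in
  if meromorphicOrderAt f ζ < 0 then OnePoint.infty else (f ζ : OnePoint ℂ)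

/-- A meromorphic `f` is univalent in `U` if it is injective there as a map to the sphere. -/
def UnivalentOn (f : ℂ → ℂ) (U : Set ℂ) : Prop :=
  Set.InjOn (sphereValue f) U

/-- Univalence in some neighbourhood of each point of (the open set) `U`. -/
def LocallyUnivalentOn (f : ℂ → ℂ) (U : Set ℂ) : Prop :=
  ∀ ζ ∈ U, ∃ V ∈ 𝓝 ζ, UnivalentOn f V

/-- The Schwarzian derivative `(f'' / f')' - (f'' / f') ^ 2 / 2`. -/
noncomputable def schwarzian (f : ℂ → ℂ) (z : ℂ) : ℂ :=
  deriv (fun w => deriv (deriv f) w / deriv f w) z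
    - 1 / 2 * (deriv (deriv f) z / deriv f z) ^ 2

end ExteriorUnivalence

/-! Put F(z) = f(1/z), k(z) = g'(1/z), l = k'/k and M = S_F - l' + l²/2. Inversion turns the
hypothesis into |½(1-|z|²)² M + (1-|z|²) z̄ l| ≤ 1 in the unit disk (`criterion_inversion`). Two
kinds of singularity must be excluded first. At a pole of g the quotient g''/g' blows up while both
Schwarzians stay bounded (`analyticAt_of_criterion`). At z = 0 the leading coefficients
(`leading_coefficients_of_criterion`), together with k'(0) = 0, force k(0) ≠ 0 and F locally
injective.

A fibre of F, as a map to the sphere, is the zero set of V = |pF + q|² |k/F'|. Off this set V = |H|²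
locally, with H² = (pF + q)² k/F', and H'' = -½MH + lH' (`second_deriv_of_sq_eq`). Consider W =
V/(ρ² - |z|²) on |z| < ρ, where ρ < 1. At a critical point with V ≠ 0, writing d = ρ² - |z|², one
has H'/H = -z̄/d, hence d²H''/H = -(½d²M + d z̄ l). This has modulus below ρ²
(`criterion_on_smaller_disk`), which makes the point a strict local minimum
(`strict_min_of_second_order`). Zeros of V are strict local minima as well.

A mountain-pass argument (`critical_point_unique_of_strict_min`) now leaves at most one critical
point: between two minima there would be one that is not a strict minimum. So every fibre of F has
at most one point. Working with ρ < 1 gives the strict inequality and, when V has no zero on |z| =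
ρ, the compactness of the sublevel sets. -/

/-! ### Mountain pass: uniqueness of critical points. -/

/-- Separation step: if all sublevel sets slightly above level `c` connect `z₁` to `z₂`,
so does the sublevel set at level `c`. -/
theorem exists_isPreconnected_of_forall_gt {X : Type*} [TopologicalSpace X] [T2Space X]
    {U : Set X} {W : X → ℝ} (hW : ContinuousOn W U)
    (hK : ∀ c : ℝ, IsCompact {z ∈ U | W z ≤ c}) {z₁ z₂ : X} {c : ℝ}
    (h : ∀ c' > c, ∃ S ⊆ {z ∈ U | W z ≤ c'}, IsPreconnected S ∧ z₁ ∈ S ∧ z₂ ∈ S) :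
    ∃ S ⊆ {z ∈ U | W z ≤ c}, IsPreconnected S ∧ z₁ ∈ S ∧ z₂ ∈ S := by
  have key : ∀ z, (∀ c' > c, ∃ S ⊆ {z ∈ U | W z ≤ c'}, IsPreconnected S ∧ z₁ ∈ S ∧ z₂ ∈ S) →
      (z = z₁ ∨ z = z₂) → z ∈ {z ∈ U | W z ≤ c} := by
    intro z h hz
    have h1 : ∀ c' > c, z ∈ {z ∈ U | W z ≤ c'} := by
      intro c' hc'
      obtain ⟨S, hS, -, h1, h2⟩ := h c' hc'
      rcases hz with rfl | rfl
      · exact hS h1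
      · exact hS h2
    exact ⟨(h1 (c + 1) (by simp)).1, le_of_forall_gt_imp_ge_of_dense fun c' hc' => (h1 c' hc').2⟩
  have hz₁ := key z₁ h (Or.inl rfl)
  have hz₂ := key z₂ h (Or.inr rfl)
  set K : Set X := {z ∈ U | W z ≤ c} with hKdef
  refine ⟨connectedComponentIn K z₁, connectedComponentIn_subset _ _,
    isPreconnected_connectedComponentIn, mem_connectedComponentIn hz₁, ?_⟩
  by_contra hcon
  have : CompactSpace K := isCompact_iff_compactSpace.1 (hK c)
  have h2 : (⟨z₂, hz₂⟩ : K) ∉ connectedComponent (⟨z₁, hz₁⟩ : K) := by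
    intro h3
    apply hcon
    rw [connectedComponentIn_eq_image hz₁]
    exact ⟨_, h3, rfl⟩
  -- In a compact Hausdorff space components are intersections of clopen sets, so some clopen set
  -- separates the two points.
  rw [connectedComponent_eq_iInter_isClopen] at h2
  simp only [Set.mem_iInter, not_forall] at h2
  obtain ⟨⟨Z, hZ, hzZ⟩, hz₂Z⟩ := h2
  have hA : IsCompact ((↑) '' Z : Set X) := hZ.1.isCompact.image continuous_subtype_val
  have hB : IsCompact ((↑) '' Zᶜ : Set X) :=
    hZ.compl.1.isCompact.image continuous_subtype_val
  have hdis : Disjoint ((↑) '' Z : Set X) ((↑) '' Zᶜ : Set X) :=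
    (Set.disjoint_image_iff Subtype.val_injective).2 disjoint_compl_right
  obtain ⟨V₁, V₂, hV₁, hV₂, hAV, hBV, hV⟩ := SeparatedNhds.of_isCompact_isCompact hA hB hdis
  have hKV : K ⊆ V₁ ∪ V₂ := by
    intro z hz
    by_cases hzZ' : (⟨z, hz⟩ : K) ∈ Z
    · exact Or.inl (hAV ⟨_, hzZ', rfl⟩)
    · exact Or.inr (hBV ⟨_, hzZ', rfl⟩)
  -- What the open sets miss of a slightly higher sublevel set is compact and has W > c throughout.
  -- A level halfway between c and the minimum of W there is still separated.
  have hcompact : IsCompact ({z ∈ U | W z ≤ c + 1} \ (V₁ ∪ V₂)) :=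
    (hK (c + 1)).diff (hV₁.union hV₂)
  obtain ⟨c', hc', hc'2⟩ : ∃ c' > c, {z ∈ U | W z ≤ c'} ⊆ V₁ ∪ V₂ := by
    rcases Set.eq_empty_or_nonempty ({z ∈ U | W z ≤ c + 1} \ (V₁ ∪ V₂)) with he | hne
    · exact ⟨c + 1, by simp, Set.sdiff_eq_empty.1 he⟩
    · obtain ⟨m, hm, hmin⟩ := hcompact.exists_isMinOn hne
        (hW.mono fun z hz => hz.1.1)
      have hmc : c < W m := by
        by_contra hle
        exact hm.2 (hKV ⟨hm.1.1, not_lt.1 hle⟩)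
      refine ⟨(c + W m) / 2, by linarith, fun z hz => ?_⟩
      by_contra hzV
      have h4 : W m ≤ W z := hmin ⟨⟨hz.1, by linarith [hz.2, hm.1.2]⟩, hzV⟩
      linarith [hz.2]
  obtain ⟨S, hS, hSc, h1, h2⟩ := h c' hc'
  obtain ⟨x, -, hx⟩ := hSc V₁ V₂ hV₁ hV₂ (hS.trans hc'2) ⟨z₁, h1, hAV ⟨_, hzZ, rfl⟩⟩
    ⟨z₂, h2, hBV ⟨⟨z₂, hz₂⟩, hz₂Z, rfl⟩⟩
  exact Set.disjoint_left.1 hV hx.1 hx.2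

/-- A `C¹` function with compact sublevel sets on a convex open set, all of whose critical points
are strict local minima, has at most one critical point. -/
theorem critical_point_unique_of_strict_min {E : Type*} [NormedAddCommGroup E]
    [InnerProductSpace ℝ E] [CompleteSpace E] {U : Set E} (hUo : IsOpen U) (hUc : Convex ℝ U)
    {W : E → ℝ} (hW : ∀ z ∈ U, ContDiffAt ℝ 1 W z)
    (hK : ∀ c : ℝ, IsCompact {z ∈ U | W z ≤ c})
    (hcrit : ∀ z ∈ U, fderiv ℝ W z = 0 → ∀ᶠ w in 𝓝[≠] z, W z < W w)
    {z₁ z₂ : E} (hz₁ : z₁ ∈ U) (hz₂ : z₂ ∈ U) (h₁ : fderiv ℝ W z₁ = 0)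
    (h₂ : fderiv ℝ W z₂ = 0) : z₁ = z₂ := by
  by_contra hne
  have hWc : ContinuousOn W U := fun z hz => (hW z hz).continuousAt.continuousWithinAt
  let J : Set ℝ := {c | ∃ S ⊆ {z ∈ U | W z ≤ c}, IsPreconnected S ∧ z₁ ∈ S ∧ z₂ ∈ S}
  have hJb : ∀ c ∈ J, W z₁ ≤ c := fun c ⟨S, hS, _, h, _⟩ => (hS h).2
  have hJbdd : BddBelow J := ⟨W z₁, hJb⟩
  have hJne : J.Nonempty := by
    have hseg : segment ℝ z₁ z₂ ⊆ U := hUc.segment_subset hz₁ hz₂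
    have hsc : IsCompact (segment ℝ z₁ z₂) := by
      rw [segment_eq_image_lineMap]
      exact isCompact_Icc.image (by fun_prop)
    obtain ⟨m, -, hm⟩ := hsc.exists_isMaxOn ⟨z₁, left_mem_segment ℝ _ _⟩ (hWc.mono hseg)
    exact ⟨W m, _, fun z hz => ⟨hseg hz, hm hz⟩, (convex_segment _ _).isPreconnected,
      left_mem_segment ℝ _ _, right_mem_segment ℝ _ _⟩
  obtain ⟨S, hS, hSc, h1S, h2S⟩ : sInf J ∈ J := by
    refine exists_isPreconnected_of_forall_gt hWc hK fun c' hc' => ?_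
    obtain ⟨c, ⟨S, hS, h⟩, hcc⟩ := exists_lt_of_csInf_lt hJne hc'
    exact ⟨S, fun z hz => ⟨(hS hz).1, (hS hz).2.trans hcc.le⟩, h⟩
  set c := sInf J with hc
  set C := closure S with hCdef
  have hCK : C ⊆ {z ∈ U | W z ≤ c} := closure_minimal hS (hK c).isClosed
  have hCc : IsCompact C := (hK c).of_isClosed_subset isClosed_closure hCK
  have hCp : IsPreconnected C := hSc.closure
  have h1C : z₁ ∈ C := subset_closure h1S
  have h2C : z₂ ∈ C := subset_closure h2S
  -- A connected set with two points has no isolated point. A strict local minimum at the top level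
  -- c would therefore have points of C above c nearby.
  have hperf := hCp.preperfect_of_nontrivial ⟨z₁, h1C, z₂, h2C, hne⟩
  have hnc : ∀ z ∈ C, W z = c → fderiv ℝ W z ≠ 0 := by
    intro z hz hzc h0
    have hev := hcrit z (hCK hz).1 h0
    have hacc := accPt_iff_frequently_nhdsNE.1 (hperf z hz)
    obtain ⟨w, hw, hwC⟩ := (hacc.and_eventually hev).exists
    have := (hCK hw).2
    linarith
  have hgc : ∀ z ∈ U, ContinuousAt (gradient W) z := by
    intro z hz
    have h3 : ContinuousAt (fderiv ℝ W) z := (hW z hz).continuousAt_fderiv (by norm_num)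
    exact (InnerProductSpace.toDual ℝ E).symm.continuous.continuousAt.comp h3
  -- One small gradient step pushes all of C below c. Membership in C is repeated inside the
  -- predicate because the compactness argument uses full neighbourhoods of (0, z), while W ≤ c is
  -- known only on C.
  have hev : ∀ᶠ ε : ℝ in 𝓝 0, ∀ z ∈ C, 0 < ε → z ∈ C →
      W (z - ε • gradient W z) < c ∧ z - ε • gradient W z ∈ U := by
    apply hCc.eventually_forall_of_forall_eventually
    intro z hz
    rw [nhds_prod_eq]
    have hzU := (hCK hz).1
    have hT : Tendsto (fun p : ℝ × E => p.2 - p.1 • gradient W p.2) (𝓝 0 ×ˢ 𝓝 z) (𝓝 z) := by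
      have h4 : ContinuousAt (fun p : ℝ × E => p.2 - p.1 • gradient W p.2) (0, z) := by
        have : ContinuousAt (fun p : ℝ × E => gradient W p.2) (0, z) :=
          ContinuousAt.comp (f := Prod.snd) (x := ((0 : ℝ), z)) (hgc z hzU) continuousAt_snd
        fun_prop
      have h5 := h4.tendsto
      rw [nhds_prod_eq] at h5
      simpa using h5
    have hU' := hT.eventually (hUo.mem_nhds hzU)
    rcases lt_or_eq_of_le (hCK hz).2 with hlt | heq
    · filter_upwards [hU', hT.eventually ((hW z hzU).continuousAt.eventually_lt_const hlt)]
        with p hp1 hp2 _ _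
      exact ⟨hp2, hp1⟩
    · have hg0 : gradient W z ≠ 0 := by
        intro h0
        apply hnc z hz heq
        rw [← toDual_gradient, h0, map_zero]
      -- Strict differentiability is needed since the base point varies too. The linear term gains
      -- more than ε‖∇W‖²/2, and the error is at most ε(‖∇W‖/8)(2‖∇W‖) = ε‖∇W‖²/4, with ∇W taken at
      -- z.
      have hsd : HasStrictFDerivAt W (fderiv ℝ W z) z :=
        (hW z hzU).hasStrictFDerivAt (by norm_num)
      have hgn : 0 < ‖gradient W z‖ := norm_pos_iff.2 hg0
      have hlit := hsd.isLittleO.def (c := ‖gradient W z‖ / 8) (by positivity)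
      have hT2 : Tendsto (fun p : ℝ × E => (p.2 - p.1 • gradient W p.2, p.2)) (𝓝 0 ×ˢ 𝓝 z)
          (𝓝 (z, z)) := by
        rw [nhds_prod_eq]
        exact hT.prodMk tendsto_snd
      have hinner : ∀ᶠ p : ℝ × E in 𝓝 0 ×ˢ 𝓝 z,
          ‖gradient W z‖ ^ 2 / 2 < inner ℝ (gradient W z) (gradient W p.2) := by
        have h6 : Tendsto (fun p : ℝ × E => inner ℝ (gradient W z) (gradient W p.2))
            (𝓝 0 ×ˢ 𝓝 z) (𝓝 (inner ℝ (gradient W z) (gradient W z))) :=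
          Tendsto.inner tendsto_const_nhds ((hgc z hzU).tendsto.comp tendsto_snd)
        refine h6.eventually (lt_mem_nhds ?_)
        rw [real_inner_self_eq_norm_sq]
        nlinarith
      have hnorm : ∀ᶠ p : ℝ × E in 𝓝 0 ×ˢ 𝓝 z, ‖gradient W p.2‖ < 2 * ‖gradient W z‖ := by
        have h6 : Tendsto (fun p : ℝ × E => ‖gradient W p.2‖) (𝓝 0 ×ˢ 𝓝 z)
            (𝓝 ‖gradient W z‖) := ((hgc z hzU).tendsto.comp tendsto_snd).norm
        exact h6.eventually (gt_mem_nhds (by linarith))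
      filter_upwards [hU', hT2.eventually hlit, hinner, hnorm] with p hp1 hp2 hp3 hp4 hε hpC
      refine ⟨?_, hp1⟩
      have hWp := (hCK hpC).2
      have h7 : fderiv ℝ W z (-(p.1 • gradient W p.2)) =
          - (p.1 * inner ℝ (gradient W z) (gradient W p.2)) := by
        rw [map_neg, map_smul, ← toDual_gradient, InnerProductSpace.toDual_apply_apply,
          smul_eq_mul]
      have h8 : p.2 - p.1 • gradient W p.2 - p.2 = -(p.1 • gradient W p.2) := by abel
      simp only [h8, h7, norm_neg, norm_smul, Real.norm_eq_abs, abs_of_pos hε] at hp2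
      have h9 := (abs_le.1 hp2).2
      have h10 : ‖gradient W z‖ / 8 * (p.1 * ‖gradient W p.2‖) ≤
          ‖gradient W z‖ / 8 * (p.1 * (2 * ‖gradient W z‖)) := by gcongr
      have h11 := mul_lt_mul_of_pos_left hp3 hε
      have h12 : 0 < p.1 * ‖gradient W z‖ ^ 2 := by positivity
      nlinarith
  obtain ⟨ε, hε, hεpos⟩ :=
    ((hev.filter_mono nhdsWithin_le_nhds).and (self_mem_nhdsWithin (s := Set.Ioi 0))).exists
  have hεpos : 0 < ε := hεpos
  have hcont : ContinuousOn (fun z => z - ε • gradient W z) C := fun z hz => by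
    have := hgc z (hCK hz).1
    have h3 : ContinuousAt (fun z => z - ε • gradient W z) z := by fun_prop
    exact h3.continuousWithinAt
  -- The gradient step fixes critical points, so the image of C still joins z₁ to z₂, now at a level
  -- below the infimum.
  have hfix : ∀ z, fderiv ℝ W z = 0 → z - ε • gradient W z = z := by
    intro z hz
    have : gradient W z = 0 := by rw [gradient, hz, map_zero]
    simp [this]
  set C' := (fun z => z - ε • gradient W z) '' C with hC'
  have hC'U : C' ⊆ U := by
    rintro _ ⟨z, hz, rfl⟩
    exact (hε z hz hεpos hz).2
  have h1C' : z₁ ∈ C' := ⟨z₁, h1C, hfix z₁ h₁⟩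
  obtain ⟨m, ⟨y, hy, rfl⟩, hmax⟩ :=
    (hCc.image_of_continuousOn hcont).exists_isMaxOn ⟨z₁, h1C'⟩ (hWc.mono hC'U)
  have hmJ : W (y - ε • gradient W y) ∈ J :=
    ⟨C', fun z hz => ⟨hC'U hz, hmax hz⟩, hCp.image _ hcont, h1C', ⟨z₂, h2C, hfix z₂ h₂⟩⟩
  have := csInf_le hJbdd hmJ
  have := (hε y hy hεpos hy).1
  linarith

/-! ### Second-order test for ‖H‖²/(ρ² - ‖z‖²). -/

theorem analyticAt_dslope {f : ℂ → ℂ} {z : ℂ} (hf : AnalyticAt ℂ f z) :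
    AnalyticAt ℂ (dslope f z) z := by
  obtain ⟨p, hp⟩ := hf
  exact ⟨_, hp.has_fpower_series_dslope_fslope⟩

/-- Dividing out z - z₀ twice leaves an analytic quadratic coefficient; its value at z₀ comes from
differentiating the identity twice. -/
theorem exists_second_order_expansion {H : ℂ → ℂ} {z₀ : ℂ} (hH : AnalyticAt ℂ H z₀) :
    ∃ h : ℂ → ℂ, AnalyticAt ℂ h z₀ ∧ h z₀ = deriv (deriv H) z₀ / 2 ∧
      ∀ z, H z = H z₀ + (z - z₀) * deriv H z₀ + (z - z₀) ^ 2 * h z := by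
  have h1 := analyticAt_dslope hH
  have h2 := analyticAt_dslope h1
  have hid : ∀ z, H z = H z₀ + (z - z₀) * deriv H z₀ +
      (z - z₀) ^ 2 * dslope (dslope H z₀) z₀ z := by
    intro z
    have e1 := sub_smul_dslope H z₀ z
    have e2 := sub_smul_dslope (dslope H z₀) z₀ z
    rw [smul_eq_mul] at e1 e2
    rw [dslope_same H] at e2
    linear_combination (-1 : ℂ) * e1 - (z - z₀) * e2
  refine ⟨_, h2, ?_, hid⟩
  set h := dslope (dslope H z₀) z₀
  have hd : deriv H =ᶠ[𝓝 z₀] fun z => deriv H z₀ + (2 * (z - z₀) * h z + (z - z₀) ^ 2 * deriv h z) := by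
    filter_upwards [h2.eventually_analyticAt] with z hz
    have h3 : HasDerivAt H (deriv H z₀ + (2 * (z - z₀) * h z + (z - z₀) ^ 2 * deriv h z)) z := by
      have h4 : HasDerivAt (fun z => z - z₀) 1 z := (hasDerivAt_id z).sub_const z₀
      have h5 := ((h4.mul_const (deriv H z₀)).const_add (H z₀)).add
        ((h4.pow 2).mul hz.differentiableAt.hasDerivAt)
      refine (h5.congr_of_eventuallyEq (Eventually.of_forall fun z => ?_)).congr_deriv ?_
      · simpa using hid z
      · simp
    exact h3.deriv
  have h3 : HasDerivAt (fun z => deriv H z₀ + (2 * (z - z₀) * h z + (z - z₀) ^ 2 * deriv h z))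
      (2 * h z₀) z₀ := by
    have h4 : HasDerivAt (fun z => z - z₀) 1 z₀ := (hasDerivAt_id z₀).sub_const z₀
    have h5 := ((((h4.const_mul 2).mul h2.differentiableAt.hasDerivAt).add
      ((h4.pow 2).mul h2.deriv.differentiableAt.hasDerivAt))).const_add (deriv H z₀)
    refine h5.congr_deriv ?_
    simp
  rw [hd.deriv_eq, h3.deriv]
  ring

theorem hasFDerivAt_normSq_analytic {H : ℂ → ℂ} {z : ℂ} (hH : DifferentiableAt ℂ H z) :
    ∃ L : ℂ →L[ℝ] ℝ, HasFDerivAt (fun z => ‖H z‖ ^ 2) L z ∧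
      ∀ w, L w = 2 * ((starRingEnd ℂ) (H z) * (deriv H z * w)).re := by
  refine ⟨_, (hH.hasDerivAt.hasFDerivAt.restrictScalars ℝ).norm_sq, fun w => ?_⟩
  simp [Complex.inner, mul_comm]
  ring

/-- Differentiating ‖H‖² = W (ρ² - ‖z‖²) where dW = 0 gives Re(H̄ H' w) = -W Re(z̄₀ w) for every w;
the directions 1 and I recover the complex identity. -/
theorem deriv_eq_of_critical {H : ℂ → ℂ} {z₀ : ℂ} {ρ : ℝ} (hz₀ : ‖z₀‖ < ρ)
    (hH : AnalyticAt ℂ H z₀) (hH0 : H z₀ ≠ 0) {W : ℂ → ℝ}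
    (hW : W =ᶠ[𝓝 z₀] fun z => ‖H z‖ ^ 2 / (ρ ^ 2 - ‖z‖ ^ 2))
    (hcrit : HasFDerivAt W (0 : ℂ →L[ℝ] ℝ) z₀) :
    deriv H z₀ = -(starRingEnd ℂ) z₀ / ((ρ ^ 2 - ‖z₀‖ ^ 2 : ℝ) : ℂ) * H z₀ := by
  have hρ : ∀ z : ℂ, ‖z‖ < ρ → 0 < ρ ^ 2 - ‖z‖ ^ 2 := fun z hz => by nlinarith [norm_nonneg z]
  have hd := hρ z₀ hz₀
  obtain ⟨L, hL, hLw⟩ := hasFDerivAt_normSq_analytic hH.differentiableAt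
  obtain ⟨L', hL', hLw'⟩ := hasFDerivAt_normSq_analytic (differentiableAt_id (𝕜 := ℂ) (x := z₀))
  have hD := hL'.const_sub (ρ ^ 2)
  have hprod := hcrit.mul hD
  have heq : (fun z => ‖H z‖ ^ 2) =ᶠ[𝓝 z₀] fun z => W z * (ρ ^ 2 - ‖id z‖ ^ 2) := by
    have hlt : ∀ᶠ z in 𝓝 z₀, ‖z‖ < ρ := (isOpen_lt continuous_norm continuous_const).mem_nhds hz₀
    filter_upwards [hW, hlt] with z hz hz2
    rw [hz, id, div_mul_cancel₀ _ (hρ z hz2).ne']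
  have huniq := hL.unique (hprod.congr_of_eventuallyEq heq)
  have hW0 : W z₀ = ‖H z₀‖ ^ 2 / (ρ ^ 2 - ‖z₀‖ ^ 2) := hW.eq_of_nhds
  have hkey : ∀ w, ((starRingEnd ℂ) (H z₀) * (deriv H z₀ * w)).re =
      - W z₀ * ((starRingEnd ℂ) z₀ * w).re := by
    intro w
    have h1 := DFunLike.congr_fun huniq w
    rw [hLw] at h1
    simp [hLw'] at h1
    simp
    linarith
  have hc : (starRingEnd ℂ) (H z₀) * deriv H z₀ = - (W z₀ : ℂ) * (starRingEnd ℂ) z₀ := by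
    apply Complex.ext
    · simpa using hkey 1
    · have := hkey Complex.I
      simp at this ⊢
      linarith
  have hdc : ((ρ ^ 2 - ‖z₀‖ ^ 2 : ℝ) : ℂ) ≠ 0 := by exact_mod_cast hd.ne'
  have hcH : (starRingEnd ℂ) (H z₀) ≠ 0 := by simpa using hH0
  apply mul_left_cancel₀ hcH
  rw [hc, hW0]
  have : (starRingEnd ℂ) (H z₀) * H z₀ = ((‖H z₀‖ ^ 2 : ℝ) : ℂ) := by
    rw [mul_comm, Complex.mul_conj, Complex.normSq_eq_norm_sq]
  rw [Complex.ofReal_div, ← this]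
  ring

/-- Second order test for `‖H z‖ ^ 2 / (ρ ^ 2 - ‖z‖ ^ 2)` at a critical point. -/
theorem strict_min_of_second_order {H : ℂ → ℂ} {z₀ : ℂ} {ρ : ℝ} (hz₀ : ‖z₀‖ < ρ)
    (hH : AnalyticAt ℂ H z₀) (hH0 : H z₀ ≠ 0)
    (h1 : deriv H z₀ = -(starRingEnd ℂ) z₀ / ((ρ ^ 2 - ‖z₀‖ ^ 2 : ℝ) : ℂ) * H z₀)
    (h2 : ‖deriv (deriv H) z₀ / H z₀‖ * (ρ ^ 2 - ‖z₀‖ ^ 2) ^ 2 < ρ ^ 2) :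
    ∀ᶠ z in 𝓝[≠] z₀,
      ‖H z₀‖ ^ 2 / (ρ ^ 2 - ‖z₀‖ ^ 2) < ‖H z‖ ^ 2 / (ρ ^ 2 - ‖z‖ ^ 2) := by
  have hρ : ∀ z : ℂ, ‖z‖ < ρ → 0 < ρ ^ 2 - ‖z‖ ^ 2 := fun z hz => by nlinarith [norm_nonneg z]
  have hd := hρ z₀ hz₀
  set d : ℝ := ρ ^ 2 - ‖z₀‖ ^ 2 with hdd
  obtain ⟨h, hh, hh0, hexp⟩ := exists_second_order_expansion hH
  set α : ℂ := -(starRingEnd ℂ) z₀ / (d : ℂ) with hα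
  -- With w = z - z₀ and H = H(z₀)(1 + αw + θw²), the first-order terms of d‖1 + αw‖² and ρ² - ‖z‖²
  -- agree and their difference is ρ²‖w‖²/d. The θ term costs at most 2d‖θ‖‖w‖²(1 + ‖α‖‖w‖), and θ
  -- tends to H''/(2H) at z₀.
  have hcont : ContinuousAt (fun z => 2 * d ^ 2 * (‖h z / H z₀‖ * (1 + ‖α‖ * ‖z - z₀‖))) z₀ := by
    have := hh.continuousAt
    fun_prop
  have hlt : ∀ᶠ z in 𝓝 z₀, 2 * d ^ 2 * (‖h z / H z₀‖ * (1 + ‖α‖ * ‖z - z₀‖)) < ρ ^ 2 := by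
    refine hcont.eventually_lt_const ?_
    beta_reduce
    rw [hh0]
    have : ‖deriv (deriv H) z₀ / 2 / H z₀‖ = ‖deriv (deriv H) z₀ / H z₀‖ / 2 := by
      rw [div_right_comm, norm_div _ (2 : ℂ)]; simp
    rw [this]
    simp only [sub_self, norm_zero, mul_zero, add_zero, mul_one]
    linarith
  have hball : ∀ᶠ z in 𝓝 z₀, ‖z‖ < ρ := (isOpen_lt continuous_norm continuous_const).mem_nhds hz₀
  filter_upwards [nhdsWithin_le_nhds hlt, nhdsWithin_le_nhds hball, self_mem_nhdsWithin]
    with z hz1 hz2 hz3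
  have hzd := hρ z hz2
  have hne : z - z₀ ≠ 0 := sub_ne_zero.2 hz3
  set w := z - z₀ with hw
  set θ := h z / H z₀ with hθ
  have hHz : H z = H z₀ * (1 + α * w + θ * w ^ 2) := by
    rw [hexp z, h1, hθ]
    field_simp
    ring
  have hHn : 0 < ‖H z₀‖ ^ 2 := by positivity
  rw [hHz, norm_mul, mul_pow, div_lt_div_iff₀ hd hzd, mul_assoc]
  refine mul_lt_mul_of_pos_left ?_ hHn
  have hzw : z = z₀ + w := by rw [hw]; ring
  have e1 : ‖z‖ ^ 2 = ‖z₀‖ ^ 2 + 2 * ((starRingEnd ℂ) z₀ * w).re + ‖w‖ ^ 2 := by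
    rw [hzw, ← Complex.normSq_eq_norm_sq, ← Complex.normSq_eq_norm_sq,
      ← Complex.normSq_eq_norm_sq]
    simp [Complex.normSq_apply]
    ring
  have e2 : ‖1 + α * w‖ ^ 2 = 1 - 2 * ((starRingEnd ℂ) z₀ * w).re / d + ‖z₀‖ ^ 2 * ‖w‖ ^ 2 / d ^ 2 := by
    have : ‖α * w‖ ^ 2 = ‖z₀‖ ^ 2 * ‖w‖ ^ 2 / d ^ 2 := by
      rw [hα, norm_mul, norm_div, norm_neg, RCLike.norm_conj, Complex.norm_real,
        Real.norm_of_nonneg hd.le, mul_pow, div_pow, div_mul_eq_mul_div]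
    have h3 : ‖1 + α * w‖ ^ 2 = 1 + 2 * (α * w).re + ‖α * w‖ ^ 2 := by
      rw [← Complex.normSq_eq_norm_sq, ← Complex.normSq_eq_norm_sq]
      simp only [Complex.normSq_apply, Complex.add_re, Complex.add_im, Complex.one_re,
        Complex.one_im]
      ring
    have h4 : (α * w).re = - ((starRingEnd ℂ) z₀ * w).re / d := by
      have : α * w = (-((starRingEnd ℂ) z₀ * w)) / (d : ℂ) := by rw [hα]; ring
      rw [this, Complex.div_ofReal_re, Complex.neg_re]
    rw [h3, this, h4]
    ring
  have e3 : ‖1 + α * w‖ - ‖θ‖ * ‖w‖ ^ 2 ≤ ‖1 + α * w + θ * w ^ 2‖ := by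
    have := norm_sub_le (1 + α * w + θ * w ^ 2) (θ * w ^ 2)
    rw [add_sub_cancel_right, norm_mul, norm_pow] at this
    linarith
  have e4 : ‖1 + α * w‖ ≤ 1 + ‖α‖ * ‖w‖ := by
    simpa using norm_add_le 1 (α * w)
  have e5 : ‖1 + α * w‖ ^ 2 - 2 * ‖θ‖ * ‖w‖ ^ 2 * (1 + ‖α‖ * ‖w‖) ≤
      ‖1 + α * w + θ * w ^ 2‖ ^ 2 := by
    have hθw : 0 ≤ ‖θ‖ * ‖w‖ ^ 2 := by positivity
    have h6 : ‖1 + α * w‖ ^ 2 - 2 * (‖θ‖ * ‖w‖ ^ 2) * ‖1 + α * w‖ ≤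
        ‖1 + α * w + θ * w ^ 2‖ ^ 2 := by
      rcases le_total 0 (‖1 + α * w‖ - ‖θ‖ * ‖w‖ ^ 2) with h7 | h7
      · nlinarith
      · nlinarith [norm_nonneg (1 + α * w), sq_nonneg ‖1 + α * w + θ * w ^ 2‖]
    nlinarith
  have hwpos : 0 < ‖w‖ ^ 2 := by positivity
  have e6 : (‖1 + α * w‖ ^ 2 - 2 * ‖θ‖ * ‖w‖ ^ 2 * (1 + ‖α‖ * ‖w‖)) * d =
      ρ ^ 2 - ‖z‖ ^ 2 +
        ‖w‖ ^ 2 / d * (ρ ^ 2 - 2 * d ^ 2 * (‖θ‖ * (1 + ‖α‖ * ‖w‖))) := by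
    rw [e1, e2]
    have : ρ ^ 2 = d + ‖z₀‖ ^ 2 := by rw [hdd]; ring
    rw [this]
    field_simp
    ring
  have e7 : 0 < ‖w‖ ^ 2 / d * (ρ ^ 2 - 2 * d ^ 2 * (‖θ‖ * (1 + ‖α‖ * ‖w‖))) :=
    mul_pos (by positivity) (by linarith)
  nlinarith [mul_le_mul_of_nonneg_right e5 hd.le]

/-! ### Two applications of the maximum principle. -/

/-- Schwarz-type self-improvement of the criterion when passing to a smaller disk. -/
theorem criterion_on_smaller_disk {M l : ℂ → ℂ}
    (hM : DifferentiableOn ℂ M (Metric.ball 0 1)) (hl : DifferentiableOn ℂ l (Metric.ball 0 1))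
    (h : ∀ z ∈ Metric.ball (0 : ℂ) 1,
      ‖(1 / 2 : ℂ) * ((1 - ‖z‖ ^ 2 : ℝ) : ℂ) ^ 2 * M z +
        ((1 - ‖z‖ ^ 2 : ℝ) : ℂ) * (starRingEnd ℂ) z * l z‖ ≤ 1)
    {ρ : ℝ} (hρ1 : ρ < 1) {w : ℂ} (hw : ‖w‖ < ρ) :
    ‖(1 / 2 : ℂ) * ((ρ ^ 2 - ‖w‖ ^ 2 : ℝ) : ℂ) ^ 2 * M w +
        ((ρ ^ 2 - ‖w‖ ^ 2 : ℝ) : ℂ) * (starRingEnd ℂ) w * l w‖ < ρ ^ 2 := by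
  have hρ0 : 0 < ρ := (norm_nonneg w).trans_lt hw
  have hρsq : ρ ^ 2 < 1 := by nlinarith
  by_cases hw0 : w = 0
  · subst hw0
    have h0 := h 0 (by simp)
    simp only [norm_zero, map_zero, mul_zero, zero_mul, add_zero, norm_mul, norm_pow,
      Complex.norm_real] at h0 ⊢
    have e : ‖ρ ^ 2 - 0 ^ 2‖ = ρ ^ 2 := by rw [Real.norm_of_nonneg (by nlinarith)]; ring
    rw [e]
    norm_num at h0 ⊢
    nlinarith [norm_nonneg (M 0), mul_pos hρ0 hρ0]
  have hwpos : 0 < ‖w‖ := norm_pos_iff.2 hw0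
  -- This s gives ρ² - ‖w‖² = ρ²(1 - s²), so the quantity at w for radius ρ can be compared with the
  -- hypothesis on ‖z‖ = s.
  obtain ⟨s, hs⟩ : ∃ s, s = ‖w‖ / ρ := ⟨_, rfl⟩
  have hs0 : 0 < s := by rw [hs]; positivity
  have hs1 : s < 1 := by rw [hs, div_lt_one hρ0]; exact hw
  have hws : ‖w‖ = s * ρ := by rw [hs]; field_simp
  have hwlt : ‖w‖ < s := by rw [hws]; nlinarith
  -- On ‖z‖ = s one has z̄ = s²/z, so this holomorphic function is the criterion times z/s² there
  -- and is bounded by 1/s. At w the bound becomes ρ²‖w‖/s = ρ³ < ρ².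
  set G : ℂ → ℂ := fun z => (1 / 2 : ℂ) * ((1 - s ^ 2 : ℝ) : ℂ) ^ 2 * (z / (s : ℂ) ^ 2) * M z +
    ((1 - s ^ 2 : ℝ) : ℂ) * l z with hG
  have hGd : DifferentiableOn ℂ G (Metric.ball 0 1) := by
    intro z hz
    have h1 := hM z hz
    have h2 := hl z hz
    fun_prop
  have hcl : Metric.closedBall (0 : ℂ) s ⊆ Metric.ball 0 1 := Metric.closedBall_subset_ball hs1
  have hsc : (s : ℂ) ≠ 0 := by exact_mod_cast hs0.ne'
  have hbound : ‖G w‖ ≤ 1 / s := by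
    refine Complex.norm_le_of_forall_mem_frontier_norm_le (U := Metric.ball (0 : ℂ) s)
      Metric.isBounded_ball ?_ ?_ (subset_closure (by simpa using hwlt))
    · refine DifferentiableOn.diffContOnCl ?_
      rw [closure_ball _ hs0.ne']
      exact hGd.mono hcl
    · intro z hz
      rw [frontier_ball _ hs0.ne', mem_sphere_zero_iff_norm] at hz
      have hz0 : z ≠ 0 := by
        rintro rfl
        simp at hz; linarith
      have h1 := h z (by simpa [hz] using hs1)
      rw [hz] at h1
      have hzz : (starRingEnd ℂ) z = (s : ℂ) ^ 2 / z := by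
        rw [eq_div_iff hz0, mul_comm, Complex.mul_conj, Complex.normSq_eq_norm_sq, hz]
        push_cast; ring
      have h2 : G z = z / (s : ℂ) ^ 2 * ((1 / 2 : ℂ) * ((1 - s ^ 2 : ℝ) : ℂ) ^ 2 * M z +
        ((1 - s ^ 2 : ℝ) : ℂ) * (starRingEnd ℂ) z * l z) := by
        rw [hzz, hG]
        field_simp
      rw [h2, norm_mul, norm_div, norm_pow, hz, Complex.norm_real, Real.norm_of_nonneg hs0.le]
      calc s / s ^ 2 * _ ≤ s / s ^ 2 * 1 := by gcongr
        _ = 1 / s := by field_simp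
  have hkey : (1 / 2 : ℂ) * ((ρ ^ 2 - ‖w‖ ^ 2 : ℝ) : ℂ) ^ 2 * M w +
      ((ρ ^ 2 - ‖w‖ ^ 2 : ℝ) : ℂ) * (starRingEnd ℂ) w * l w =
      (ρ : ℂ) ^ 2 * (starRingEnd ℂ) w * G w := by
    have e1 : ((ρ ^ 2 - ‖w‖ ^ 2 : ℝ) : ℂ) = (ρ : ℂ) ^ 2 * ((1 - s ^ 2 : ℝ) : ℂ) := by
      rw [hws]; push_cast; ring
    have e2 : (starRingEnd ℂ) w * w = (s : ℂ) ^ 2 * (ρ : ℂ) ^ 2 := by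
      rw [mul_comm, Complex.mul_conj, Complex.normSq_eq_norm_sq, hws]
      push_cast; ring
    rw [e1, hG]
    have e3 : (ρ : ℂ) ^ 2 * (starRingEnd ℂ) w * (w / (s : ℂ) ^ 2) = (ρ : ℂ) ^ 4 := by
      rw [mul_assoc, mul_div_assoc', e2]
      field_simp
    linear_combination (-(1 / 2 : ℂ) * ((1 - s ^ 2 : ℝ) : ℂ) ^ 2 * M w) * e3
  rw [hkey, norm_mul, norm_mul, norm_pow, Complex.norm_real, Real.norm_of_nonneg hρ0.le,
    RCLike.norm_conj]
  have h3 : ‖w‖ * ‖G w‖ ≤ ρ := by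
    calc ‖w‖ * ‖G w‖ ≤ ‖w‖ * (1 / s) := by gcongr
      _ = ρ := by rw [hws]; field_simp
  have : ρ ^ 2 * ‖w‖ * ‖G w‖ ≤ ρ ^ 2 * ρ := by
    rw [mul_assoc]; gcongr
  nlinarith [mul_pos hρ0 hρ0]

/-- The criterion near a possible singular point `0` forces the leading coefficients. -/
theorem leading_coefficients_of_criterion {A B : ℂ → ℂ} (hA : AnalyticAt ℂ A 0)
    (hB : AnalyticAt ℂ B 0)
    (h : ∀ᶠ z in 𝓝[≠] (0 : ℂ), ‖((1 - ‖z‖ ^ 2 : ℝ) : ℂ) *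
      ((1 / 2 : ℂ) * ((1 - ‖z‖ ^ 2 : ℝ) : ℂ) * A z / (‖z‖ : ℂ) ^ 2 + B z)‖ ≤ 1) :
    A 0 = 0 ∧ ‖B 0‖ ≤ 1 := by
  have h1 : ∀ᶠ z in 𝓝 (0 : ℂ), AnalyticAt ℂ A z ∧ AnalyticAt ℂ B z ∧ (z ≠ 0 →
      ‖((1 - ‖z‖ ^ 2 : ℝ) : ℂ) *
      ((1 / 2 : ℂ) * ((1 - ‖z‖ ^ 2 : ℝ) : ℂ) * A z / (‖z‖ : ℂ) ^ 2 + B z)‖ ≤ 1) :=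
    hA.eventually_analyticAt.and (hB.eventually_analyticAt.and
      (eventually_nhdsWithin_iff.1 h))
  obtain ⟨ε, hε, hball⟩ := Metric.eventually_nhds_iff_ball.1 h1
  -- Freezing ‖z‖ at r makes the expression holomorphic in z without changing it on the circle, so
  -- the bound passes to the centre.
  have h2 : ∀ r : ℝ, 0 < r → r < ε → ‖((1 - r ^ 2 : ℝ) : ℂ) *
      ((1 / 2 : ℂ) * ((1 - r ^ 2 : ℝ) : ℂ) * A 0 / (r : ℂ) ^ 2 + B 0)‖ ≤ 1 := by
    intro r hr hrε
    have hcl : Metric.closedBall (0 : ℂ) r ⊆ Metric.ball 0 ε := Metric.closedBall_subset_ball hrε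
    refine Complex.norm_le_of_forall_mem_frontier_norm_le (U := Metric.ball (0 : ℂ) r)
      (f := fun z => ((1 - r ^ 2 : ℝ) : ℂ) *
        ((1 / 2 : ℂ) * ((1 - r ^ 2 : ℝ) : ℂ) * A z / (r : ℂ) ^ 2 + B z))
      Metric.isBounded_ball ?_ ?_ (subset_closure (by simpa using hr))
    · refine DifferentiableOn.diffContOnCl fun z hz => ?_
      rw [closure_ball _ hr.ne'] at hz
      have h3 := (hball z (hcl hz)).1.differentiableAt
      have h4 := (hball z (hcl hz)).2.1.differentiableAt
      have : DifferentiableAt ℂ (fun z => ((1 - r ^ 2 : ℝ) : ℂ) *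
        ((1 / 2 : ℂ) * ((1 - r ^ 2 : ℝ) : ℂ) * A z / (r : ℂ) ^ 2 + B z)) z := by fun_prop
      exact this.differentiableWithinAt
    · intro z hz
      rw [frontier_ball _ hr.ne', mem_sphere_zero_iff_norm] at hz
      have hz0 : z ≠ 0 := by
        rintro rfl
        simp at hz; linarith
      have := (hball z (by simpa [hz] using hrε)).2.2 hz0
      rwa [hz] at this
  have hev : ∀ᶠ r : ℝ in 𝓝[>] 0, 0 < r ∧ r < ε :=
    (eventually_nhdsWithin_of_forall fun r hr => hr).and
      (nhdsWithin_le_nhds (gt_mem_nhds hε))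
  have hA0 : A 0 = 0 := by
    have hc : ContinuousAt (fun r : ℝ => ‖((1 - r ^ 2 : ℝ) : ℂ) *
      ((1 / 2 : ℂ) * ((1 - r ^ 2 : ℝ) : ℂ) * A 0 + (r : ℂ) ^ 2 * B 0)‖ - r ^ 2) 0 := by fun_prop
    have hle := le_of_tendsto (hc.tendsto.mono_left (nhdsWithin_le_nhds (s := Set.Ioi 0)))
      (hev.mono fun r hr => (?_ : _ ≤ (0 : ℝ)))
    · have : 2⁻¹ * ‖A 0‖ ≤ 0 := by simpa using hle
      exact norm_le_zero_iff.1 (by linarith)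
    · have h3 := h2 r hr.1 hr.2
      have hrc : (r : ℂ) ≠ 0 := by exact_mod_cast hr.1.ne'
      have e : ((1 - r ^ 2 : ℝ) : ℂ) *
          ((1 / 2 : ℂ) * ((1 - r ^ 2 : ℝ) : ℂ) * A 0 + (r : ℂ) ^ 2 * B 0) =
          (r : ℂ) ^ 2 * (((1 - r ^ 2 : ℝ) : ℂ) *
          ((1 / 2 : ℂ) * ((1 - r ^ 2 : ℝ) : ℂ) * A 0 / (r : ℂ) ^ 2 + B 0)) := by
        field_simp
      rw [e, norm_mul, norm_pow, Complex.norm_real, Real.norm_of_nonneg hr.1.le]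
      nlinarith [mul_pos hr.1 hr.1]
  refine ⟨hA0, ?_⟩
  have hc : ContinuousAt (fun r : ℝ => ‖((1 - r ^ 2 : ℝ) : ℂ) * B 0‖) 0 := by fun_prop
  have hle := le_of_tendsto (hc.tendsto.mono_left (nhdsWithin_le_nhds (s := Set.Ioi 0)))
    (hev.mono fun r hr => (?_ : _ ≤ (1 : ℝ)))
  · simpa using hle
  · have h3 := h2 r hr.1 hr.2
    simpa [hA0] using h3

/-! ### Local injectivity and analytic roots. -/

/-- A locally injective analytic function has nonvanishing derivative. -/
theorem deriv_ne_zero_of_injOn_nhds {f : ℂ → ℂ} {z₀ : ℂ} (hf : AnalyticAt ℂ f z₀) {V : Set ℂ}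
    (hV : V ∈ 𝓝 z₀) (hinj : Set.InjOn f V) : deriv f z₀ ≠ 0 := by
  intro hd
  have hnc : ¬ ∀ᶠ z in 𝓝 z₀, f z - f z₀ = 0 := by
    intro h
    have hV' : ∀ᶠ z in 𝓝 z₀, z ∈ V := hV
    obtain ⟨z, ⟨hz, hzV⟩, hz0⟩ := (((h.and hV').filter_mono nhdsWithin_le_nhds).and
      (self_mem_nhdsWithin (s := {z₀}ᶜ))).exists
    exact hz0 (hinj hzV (mem_of_mem_nhds hV) (sub_eq_zero.1 hz))
  obtain ⟨n, g, hg, hg0, hfg⟩ :=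
    (AnalyticAt.exists_eventuallyEq_pow_smul_nonzero_iff (hf.sub analyticAt_const)).2 hnc
  have hn0 : n ≠ 0 := by
    rintro rfl
    have := hfg.self_of_nhds
    simp at this
    exact hg0 this.symm
  have hn1 : n ≠ 1 := by
    rintro rfl
    have h1 : f =ᶠ[𝓝 z₀] fun z => f z₀ + (z - z₀) * g z := by
      filter_upwards [hfg] with z hz
      simp only [Pi.sub_apply, pow_one, smul_eq_mul] at hz
      rw [← hz]; ring
    have h2 : HasDerivAt (fun z => f z₀ + (z - z₀) * g z) (g z₀) z₀ := by
      have := ((((hasDerivAt_id z₀).sub_const z₀).mul hg.differentiableAt.hasDerivAt)).const_add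
        (f z₀)
      refine this.congr_deriv ?_
      simp
    rw [h1.deriv_eq, h2.deriv] at hd
    exact hg0 hd
  -- Dividing by `g z₀` puts the base of the power near 1, off the branch cut. Up to the constant `g
  -- z₀`, f - f(z₀) is then the n-th power of a local homeomorphism, whose preimages of t and ωt
  -- contradict injectivity.
  set R : ℂ → ℂ := fun z => (g z / g z₀) ^ ((n : ℂ)⁻¹) with hR
  have hRa : AnalyticAt ℂ R z₀ := by
    refine (hg.div analyticAt_const hg0).cpow analyticAt_const ?_
    simp [hg0]
  have hR0 : R z₀ = 1 := by simp [hR, hg0]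
  have hφ : HasStrictDerivAt (fun z => (z - z₀) * R z) 1 z₀ := by
    have h0 : HasStrictDerivAt (fun z => z - z₀) 1 z₀ := (hasStrictDerivAt_id z₀).sub_const z₀
    have h1 := h0.mul hRa.hasStrictDerivAt
    refine h1.congr_deriv ?_
    simp [hR0]
  have hmap := hφ.map_nhds_eq one_ne_zero
  have hS : {z | z ∈ V ∧ (f z - f z₀) = (z - z₀) ^ n * g z} ∈ 𝓝 z₀ := by
    filter_upwards [hV, hfg] with z hz hz2
    exact ⟨hz, by simpa using hz2⟩
  have himg := image_mem_map (m := fun z => (z - z₀) * R z) hS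
  rw [hmap] at himg
  simp only [sub_self, zero_mul] at himg
  set ω : ℂ := Complex.exp (2 * Real.pi * Complex.I / n) with hω
  have hprim : IsPrimitiveRoot ω n := Complex.isPrimitiveRoot_exp n hn0
  have hω1 : ω ≠ 1 := hprim.ne_one (by omega)
  have hT : Tendsto (fun t : ℂ => ω * t) (𝓝 0) (𝓝 0) := by
    have : Continuous fun t : ℂ => ω * t := by fun_prop
    simpa using this.tendsto 0
  obtain ⟨t, ⟨ht1, ht2⟩, ht0⟩ := (((Filter.Eventually.and himg (hT himg)).filter_mono
    nhdsWithin_le_nhds).and (self_mem_nhdsWithin (s := {(0 : ℂ)}ᶜ))).exists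
  obtain ⟨x, ⟨hxV, hxf⟩, hxt⟩ := ht1
  obtain ⟨y, ⟨hyV, hyf⟩, hyt⟩ := ht2
  have hpow : ∀ z, ((z - z₀) * R z) ^ n * g z₀ = (z - z₀) ^ n * g z := by
    intro z
    rw [mul_pow, hR, Complex.cpow_nat_inv_pow _ hn0]
    field_simp
  have hfxy : f x = f y := by
    have h1 := hpow x
    have h2 := hpow y
    simp only at hxt hyt
    rw [hxt, ← hxf] at h1
    rw [hyt, ← hyf, mul_pow, hprim.pow_eq_one, one_mul] at h2
    exact sub_left_injective (h1.symm.trans h2)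
  have hxy := hinj hxV hyV hfxy
  subst hxy
  simp only at hxt hyt
  rw [hxt] at hyt
  have ht0 : t ≠ 0 := ht0
  exact hω1 (mul_right_cancel₀ ht0 (by rw [← hyt, one_mul]))

/-- The quotient by `q z₀` stays off the branch cut near z₀, which gives analyticity there; the
squared identity needs no branch condition and so holds everywhere. -/
theorem exists_analytic_sqrt {q : ℂ → ℂ} {z₀ : ℂ} (hq : AnalyticAt ℂ q z₀) (h0 : q z₀ ≠ 0) :
    ∃ H : ℂ → ℂ, AnalyticAt ℂ H z₀ ∧ ∀ z, H z ^ 2 = q z := by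
  obtain ⟨c, hc⟩ := IsAlgClosed.exists_pow_nat_eq (q z₀) (n := 2) (by norm_num)
  refine ⟨fun z => c * (q z / q z₀) ^ (((2 : ℕ) : ℂ)⁻¹), analyticAt_const.mul
    ((hq.div analyticAt_const h0).cpow analyticAt_const (by simp [h0])), fun z => ?_⟩
  rw [mul_pow, Complex.cpow_nat_inv_pow _ (by norm_num), hc]
  field_simp

/-! ### Sphere charts and the Schwarzian under inversions. -/

namespace ExteriorUnivalence

/-- `f` is locally biholomorphic at `z` as a map to the Riemann sphere. -/
def IsSphereChartAt (f : ℂ → ℂ) (z : ℂ) : Prop :=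
  (AnalyticAt ℂ f z ∧ deriv f z ≠ 0) ∨
    (AnalyticAt ℂ f⁻¹ z ∧ f⁻¹ z = 0 ∧ deriv f⁻¹ z ≠ 0)

theorem sphereValue_of_analyticAt {f : ℂ → ℂ} {z : ℂ} (hf : AnalyticAt ℂ f z) :
    sphereValue f z = (f z : OnePoint ℂ) := by
  rw [sphereValue, if_neg (not_lt.2 hf.meromorphicOrderAt_nonneg)]

theorem sphereValue_of_not_analyticAt {f : ℂ → ℂ} {z : ℂ} (hf : MeromorphicNFAt f z)
    (h : ¬ AnalyticAt ℂ f z) : sphereValue f z = OnePoint.infty := by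
  rw [sphereValue, if_pos]
  rwa [← not_le, hf.meromorphicOrderAt_nonneg_iff_analyticAt]

/-- At a pole the injectivity passes to `f⁻¹`, which near the pole is analytic and vanishes only
there. -/
theorem isSphereChartAt_of_univalentOn {f : ℂ → ℂ} {z₀ : ℂ} (hf : MeromorphicNFAt f z₀)
    {V : Set ℂ} (hV : V ∈ 𝓝 z₀) (hinj : UnivalentOn f V) : IsSphereChartAt f z₀ := by
  by_cases hfa : AnalyticAt ℂ f z₀
  · left
    refine ⟨hfa, deriv_ne_zero_of_injOn_nhds hfa (inter_mem hV hfa.eventually_analyticAt) ?_⟩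
    rintro x ⟨hx, hxa⟩ y ⟨hy, hya⟩ hxy
    apply hinj hx hy
    rw [sphereValue_of_analyticAt hxa, sphereValue_of_analyticAt hya, hxy]
  · right
    have hlt : meromorphicOrderAt f z₀ < 0 := by
      rwa [← not_le, hf.meromorphicOrderAt_nonneg_iff_analyticAt]
    have hinva : AnalyticAt ℂ f⁻¹ z₀ := by
      rw [← hf.inv.meromorphicOrderAt_nonneg_iff_analyticAt, meromorphicOrderAt_inv]
      generalize meromorphicOrderAt f z₀ = m at hlt
      cases m with
      | top => simp at hlt
      | coe m =>
        have : m < 0 := by exact_mod_cast hlt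
        have h2 : (0 : ℤ) ≤ -m := by omega
        exact_mod_cast h2
    have h0 : f⁻¹ z₀ = 0 := by
      by_contra hne
      apply hfa
      simpa using hinva.inv hne
    refine ⟨hinva, h0, ?_⟩
    have hne : ∀ᶠ z in 𝓝 z₀, z ≠ z₀ → f⁻¹ z ≠ 0 := by
      refine eventually_nhdsWithin_iff (s := {z₀}ᶜ).1 ?_
      have h1 := tendsto_cobounded_of_meromorphicOrderAt_neg hlt
      filter_upwards [h1.eventually (eventually_ne_cobounded 0)] with z hz
      simpa using hz
    refine deriv_ne_zero_of_injOn_nhds hinva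
      (inter_mem hV (inter_mem hinva.eventually_analyticAt hne)) ?_
    have haux : ∀ x, AnalyticAt ℂ f⁻¹ x → f⁻¹ x ≠ 0 → AnalyticAt ℂ f x := by
      intro x hx hx0
      simpa using hx.inv hx0
    rintro x ⟨hx, hxa, hx0⟩ y ⟨hy, hya, hy0⟩ hxy
    have hxa : AnalyticAt ℂ f⁻¹ x := hxa
    have hya : AnalyticAt ℂ f⁻¹ y := hya
    by_cases hxz : x = z₀ <;> by_cases hyz : y = z₀
    · rw [hxz, hyz]
    · exact absurd (by rw [← hxy, hxz, h0]) (hy0 hyz)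
    · exact absurd (by rw [hxy, hyz, h0]) (hx0 hxz)
    · apply hinj hx hy
      rw [sphereValue_of_analyticAt (haux x hxa (hx0 hxz)),
        sphereValue_of_analyticAt (haux y hya (hy0 hyz))]
      exact congrArg _ (inv_injective hxy)

/-- The pre-Schwarzian `F'' / F'`. -/
noncomputable def preSchwarzian (F : ℂ → ℂ) (z : ℂ) : ℂ := deriv (deriv F) z / deriv F z

theorem schwarzian_eq (F : ℂ → ℂ) (z : ℂ) :
    schwarzian F z = deriv (preSchwarzian F) z - 1 / 2 * preSchwarzian F z ^ 2 := rfl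

theorem preSchwarzian_analyticAt {F : ℂ → ℂ} {z : ℂ} (hF : AnalyticAt ℂ F z)
    (h0 : deriv F z ≠ 0) : AnalyticAt ℂ (preSchwarzian F) z :=
  hF.deriv.deriv.div hF.deriv h0

theorem schwarzian_analyticAt {F : ℂ → ℂ} {z : ℂ} (hF : AnalyticAt ℂ F z)
    (h0 : deriv F z ≠ 0) : AnalyticAt ℂ (schwarzian F) z :=
  (preSchwarzian_analyticAt hF h0).deriv.sub
    (analyticAt_const.mul ((preSchwarzian_analyticAt hF h0).pow 2))

theorem schwarzian_congr {F G : ℂ → ℂ} {z : ℂ} (h : F =ᶠ[𝓝 z] G) :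
    schwarzian F z = schwarzian G z := by
  have h1 : preSchwarzian F =ᶠ[𝓝 z] preSchwarzian G := by
    filter_upwards [h.deriv, h.deriv.deriv] with w hw hw2
    rw [preSchwarzian, preSchwarzian, hw, hw2]
  rw [schwarzian_eq, schwarzian_eq, h1.deriv_eq, h1.eq_of_nhds]

theorem preSchwarzian_inv {F : ℂ → ℂ} {z : ℂ} (hF : AnalyticAt ℂ F z)
    (h0 : F z ≠ 0) (h1 : deriv F z ≠ 0) :
    preSchwarzian F⁻¹ z = preSchwarzian F z - 2 * deriv F z / F z := by
  have hd : deriv F⁻¹ =ᶠ[𝓝 z] fun w => -deriv F w / F w ^ 2 := by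
    filter_upwards [hF.eventually_analyticAt, hF.continuousAt.eventually_ne h0] with w hw hw0
    exact (hw.differentiableAt.hasDerivAt.inv hw0).deriv
  have hdd : HasDerivAt (fun w => -deriv F w / F w ^ 2)
      ((-deriv (deriv F) z * F z ^ 2 - -deriv F z * (2 * F z * deriv F z)) / (F z ^ 2) ^ 2) z := by
    refine (hF.deriv.differentiableAt.hasDerivAt.neg.div
      (hF.differentiableAt.hasDerivAt.pow 2) (pow_ne_zero 2 h0)).congr_deriv ?_
    simp
  rw [preSchwarzian, preSchwarzian, hd.deriv_eq, hdd.deriv, hd.eq_of_nhds]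
  field_simp
  ring

/-- Möbius invariance for w ↦ 1/w; this is what lets the Schwarzian extend across simple poles. -/
theorem schwarzian_inv {F : ℂ → ℂ} {z : ℂ} (hF : AnalyticAt ℂ F z)
    (h0 : F z ≠ 0) (h1 : deriv F z ≠ 0) : schwarzian F⁻¹ z = schwarzian F z := by
  have hP : preSchwarzian F⁻¹ =ᶠ[𝓝 z] fun w => preSchwarzian F w - 2 * deriv F w / F w := by
    filter_upwards [hF.eventually_analyticAt, hF.continuousAt.eventually_ne h0,
      hF.deriv.continuousAt.eventually_ne h1] with w hw hw0 hw1
    exact preSchwarzian_inv hw hw0 hw1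
  have hd : HasDerivAt (fun w => preSchwarzian F w - 2 * deriv F w / F w)
      (deriv (preSchwarzian F) z -
        (2 * deriv (deriv F) z * F z - 2 * deriv F z * deriv F z) / F z ^ 2) z :=
    (preSchwarzian_analyticAt hF h1).differentiableAt.hasDerivAt.sub
      ((hF.deriv.differentiableAt.hasDerivAt.const_mul 2).div hF.differentiableAt.hasDerivAt h0)
  have h2 : deriv (deriv F) z = preSchwarzian F z * deriv F z := by
    rw [preSchwarzian]; field_simp
  rw [schwarzian_eq, schwarzian_eq, hP.deriv_eq, hd.deriv, hP.eq_of_nhds, h2]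
  field_simp
  ring

theorem deriv_comp_inv {f : ℂ → ℂ} {z : ℂ} (hz : z ≠ 0) (hf : AnalyticAt ℂ f z⁻¹) :
    deriv (fun w => f w⁻¹) z = -deriv f z⁻¹ / z ^ 2 := by
  have h1 : HasDerivAt (fun w => f w⁻¹) (deriv f z⁻¹ * -(z ^ 2)⁻¹) z :=
    HasDerivAt.comp z hf.differentiableAt.hasDerivAt (hasDerivAt_inv hz)
  rw [h1.deriv]
  ring

theorem analyticAt_comp_inv {f : ℂ → ℂ} {z : ℂ} (hz : z ≠ 0) (hf : AnalyticAt ℂ f z⁻¹) :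
    AnalyticAt ℂ (fun w => f w⁻¹) z :=
  AnalyticAt.comp (g := f) (f := fun w => w⁻¹) hf (analyticAt_inv hz)

theorem eventually_comp_inv {f : ℂ → ℂ} {z : ℂ} (hz : z ≠ 0) (hf : AnalyticAt ℂ f z⁻¹) :
    ∀ᶠ w in 𝓝 z, w ≠ 0 ∧ AnalyticAt ℂ f w⁻¹ :=
  (eventually_ne_nhds hz).and ((continuousAt_inv₀ hz).eventually hf.eventually_analyticAt)

theorem preSchwarzian_comp_inv {f : ℂ → ℂ} {z : ℂ} (hz : z ≠ 0) (hf : AnalyticAt ℂ f z⁻¹)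
    (h1 : deriv f z⁻¹ ≠ 0) :
    preSchwarzian (fun w => f w⁻¹) z = -preSchwarzian f z⁻¹ / z ^ 2 - 2 / z := by
  have hd : deriv (fun w => f w⁻¹) =ᶠ[𝓝 z] fun w => -deriv f w⁻¹ / w ^ 2 := by
    filter_upwards [eventually_comp_inv hz hf] with w hw
    exact deriv_comp_inv hw.1 hw.2
  have h2 : HasDerivAt (fun w => deriv f w⁻¹) (-deriv (deriv f) z⁻¹ / z ^ 2) z := by
    rw [← deriv_comp_inv hz hf.deriv]
    exact (analyticAt_comp_inv hz hf.deriv).differentiableAt.hasDerivAt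
  have h3 : HasDerivAt (fun w => -deriv f w⁻¹ / w ^ 2)
      ((-(-deriv (deriv f) z⁻¹ / z ^ 2) * z ^ 2 - -deriv f z⁻¹ * (2 * z)) / (z ^ 2) ^ 2) z := by
    refine (h2.neg.div ((hasDerivAt_id z).pow 2) (pow_ne_zero 2 hz)).congr_deriv ?_
    simp
  rw [preSchwarzian, preSchwarzian, hd.deriv_eq, h3.deriv, hd.eq_of_nhds]
  generalize deriv f z⁻¹ = d at h1
  generalize deriv (deriv f) z⁻¹ = e
  field_simp
  ring

/-- An instance of the chain rule S(f∘φ) = (S_f∘φ)φ'² + S_φ, where φ(z) = 1/z has S_φ = 0 and φ'² =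
z⁻⁴. -/
theorem schwarzian_comp_inv {f : ℂ → ℂ} {z : ℂ} (hz : z ≠ 0) (hf : AnalyticAt ℂ f z⁻¹)
    (h1 : deriv f z⁻¹ ≠ 0) :
    schwarzian (fun w => f w⁻¹) z = schwarzian f z⁻¹ / z ^ 4 := by
  have hP : preSchwarzian (fun w => f w⁻¹) =ᶠ[𝓝 z]
      fun w => -preSchwarzian f w⁻¹ / w ^ 2 - 2 / w := by
    filter_upwards [eventually_comp_inv hz hf,
      (continuousAt_inv₀ hz).eventually (hf.deriv.continuousAt.eventually_ne h1)] with w hw hw1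
    exact preSchwarzian_comp_inv hw.1 hw.2 hw1
  have hPa := preSchwarzian_analyticAt hf h1
  have h2 : HasDerivAt (fun w => preSchwarzian f w⁻¹)
      (-deriv (preSchwarzian f) z⁻¹ / z ^ 2) z := by
    rw [← deriv_comp_inv hz hPa]
    exact (analyticAt_comp_inv hz hPa).differentiableAt.hasDerivAt
  have h3 : HasDerivAt (fun w => -preSchwarzian f w⁻¹ / w ^ 2 - 2 / w)
      ((-(-deriv (preSchwarzian f) z⁻¹ / z ^ 2) * z ^ 2 - -preSchwarzian f z⁻¹ * (2 * z)) /
        (z ^ 2) ^ 2 - (0 * z - 2 * 1) / z ^ 2) z := by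
    refine ((h2.neg.div ((hasDerivAt_id z).pow 2) (pow_ne_zero 2 hz)).sub
      ((hasDerivAt_const z 2).div (hasDerivAt_id z) hz)).congr_deriv ?_
    simp
  rw [schwarzian_eq, schwarzian_eq, hP.deriv_eq, h3.deriv, hP.eq_of_nhds]
  field_simp
  ring

end ExteriorUnivalence

/-! ### From the second-order condition to uniqueness of zeros. -/

/-- A function which is locally `‖N‖ ^ 2 * ‖E‖` with `N`, `E` analytic, `E` zero free, and which
satisfies a second order condition at the critical points of `V / (ρ ^ 2 - ‖z‖ ^ 2)` has at most
one zero in the disk of radius `ρ`. -/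
theorem zero_unique_of_second_order {ρ : ℝ} {V : ℂ → ℝ}
    (hVc : ContinuousOn V (Metric.closedBall 0 ρ)) (hV0 : ∀ z, 0 ≤ V z)
    (hsph : ∀ z, ‖z‖ = ρ → V z ≠ 0)
    (hloc : ∀ z₀, ‖z₀‖ < ρ → ∃ N E : ℂ → ℂ, AnalyticAt ℂ N z₀ ∧ AnalyticAt ℂ E z₀ ∧ E z₀ ≠ 0 ∧
      (V =ᶠ[𝓝 z₀] fun z => ‖N z‖ ^ 2 * ‖E z‖) ∧ (N z₀ = 0 → deriv N z₀ ≠ 0) ∧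
      (N z₀ ≠ 0 → ∀ H : ℂ → ℂ, AnalyticAt ℂ H z₀ → (∀ z, H z ^ 2 = N z ^ 2 * E z) →
        deriv H z₀ = -(starRingEnd ℂ) z₀ / ((ρ ^ 2 - ‖z₀‖ ^ 2 : ℝ) : ℂ) * H z₀ →
        ‖deriv (deriv H) z₀ / H z₀‖ * (ρ ^ 2 - ‖z₀‖ ^ 2) ^ 2 < ρ ^ 2))
    {z₁ z₂ : ℂ} (h₁ : ‖z₁‖ < ρ) (h₂ : ‖z₂‖ < ρ) (hz₁ : V z₁ = 0) (hz₂ : V z₂ = 0) :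
    z₁ = z₂ := by
  have hρ : ∀ z : ℂ, ‖z‖ < ρ → 0 < ρ ^ 2 - ‖z‖ ^ 2 := fun z hz => by nlinarith [norm_nonneg z]
  have hlt : ∀ z₀ : ℂ, ‖z₀‖ < ρ → ∀ᶠ z in 𝓝 z₀, ‖z‖ < ρ := fun z₀ hz₀ =>
    (isOpen_lt continuous_norm continuous_const).mem_nhds hz₀
  set W : ℂ → ℝ := fun z => V z / (ρ ^ 2 - ‖z‖ ^ 2) with hW
  have hW0 : ∀ z, ‖z‖ < ρ → 0 ≤ W z := fun z hz => div_nonneg (hV0 z) (hρ z hz).le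
  have hmin : ∀ z, ‖z‖ < ρ → V z = 0 → fderiv ℝ W z = 0 := by
    intro z hz hVz
    refine IsLocalMin.fderiv_eq_zero ?_
    filter_upwards [hlt z hz] with w hw
    have : W z = 0 := by simp [hW, hVz]
    rw [this]
    exact hW0 w hw
  refine critical_point_unique_of_strict_min (U := Metric.ball (0 : ℂ) ρ) Metric.isOpen_ball
    (convex_ball 0 ρ) (W := W) ?_ ?_ ?_ (by simpa using h₁) (by simpa using h₂)
    (hmin z₁ h₁ hz₁) (hmin z₂ h₂ hz₂)
  · intro z₀ hz₀
    rw [mem_ball_zero_iff] at hz₀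
    obtain ⟨N, E, hN, hE, hE0, hVe, -, -⟩ := hloc z₀ hz₀
    have hNs : ContDiffAt ℝ 1 N z₀ := hN.contDiffAt.restrict_scalars ℝ
    have hEs : ContDiffAt ℝ 1 E z₀ := hE.contDiffAt.restrict_scalars ℝ
    have h3 : ContDiffAt ℝ 1 (fun z => ‖N z‖ ^ 2 * ‖E z‖ / (ρ ^ 2 - ‖z‖ ^ 2)) z₀ :=
      ((hNs.norm_sq ℝ).mul (hEs.norm ℝ hE0)).div
        (contDiffAt_const.sub (contDiffAt_id.norm_sq ℝ)) (hρ z₀ hz₀).ne'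
    refine h3.congr_of_eventuallyEq ?_
    filter_upwards [hVe] with z hz
    simp only [hW, hz]
  · intro c
    -- Clearing the denominator, the bound on the boundary circle would read V ≤ 0, which is
    -- excluded there; so the sublevel set is closed in the closed disk.
    have he : {z ∈ Metric.ball (0 : ℂ) ρ | W z ≤ c} =
        {z ∈ Metric.closedBall (0 : ℂ) ρ | V z ≤ c * (ρ ^ 2 - ‖z‖ ^ 2)} := by
      ext z
      simp only [Set.mem_ofPred_eq, mem_ball_zero_iff, mem_closedBall_zero_iff, hW]
      constructor
      · rintro ⟨hz, hc⟩
        exact ⟨hz.le, (div_le_iff₀ (hρ z hz)).1 hc⟩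
      · rintro ⟨hz, hc⟩
        rcases hz.lt_or_eq with hz | hz
        · exact ⟨hz, (div_le_iff₀ (hρ z hz)).2 hc⟩
        · rw [hz, sub_self, mul_zero] at hc
          exact absurd (le_antisymm hc (hV0 z)) (hsph z hz)
    rw [he]
    refine (isCompact_closedBall (0 : ℂ) ρ).of_isClosed_subset ?_ fun z hz => hz.1
    exact Metric.isClosed_closedBall.isClosed_le hVc (by fun_prop)
  · intro z₀ hz₀ hcrit
    rw [mem_ball_zero_iff] at hz₀
    obtain ⟨N, E, hN, hE, hE0, hVe, hN1, hH⟩ := hloc z₀ hz₀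
    by_cases hN0 : N z₀ = 0
    · have hne : ∀ᶠ z in 𝓝[≠] z₀, N z ≠ 0 := by
        have := hN.differentiableAt.hasDerivAt.eventually_ne (hN1 hN0) (c := 0)
        simpa [hN0] using this
      have hWz : W z₀ = 0 := by simp [hW, hVe.eq_of_nhds, hN0]
      filter_upwards [hne, nhdsWithin_le_nhds hVe, nhdsWithin_le_nhds (hlt z₀ hz₀),
        nhdsWithin_le_nhds (hE.continuousAt.eventually_ne hE0)] with z hz1 hz2 hz3 hz4
      rw [hWz]
      have := hρ z hz3
      simp only [hW, hz2]
      positivity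
    · obtain ⟨H, hHa, hHq⟩ := exists_analytic_sqrt (q := fun z => N z ^ 2 * E z)
        ((hN.pow 2).mul hE) (mul_ne_zero (pow_ne_zero 2 hN0) hE0)
      have hH0 : H z₀ ≠ 0 := by
        intro h
        have := hHq z₀
        rw [h] at this
        simp [hN0, hE0] at this
      have hVH : V =ᶠ[𝓝 z₀] fun z => ‖H z‖ ^ 2 := by
        filter_upwards [hVe] with z hz
        rw [hz, ← norm_pow, ← norm_pow, hHq z, norm_mul]
      have hWH : W =ᶠ[𝓝 z₀] fun z => ‖H z‖ ^ 2 / (ρ ^ 2 - ‖z‖ ^ 2) := by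
        filter_upwards [hVH] with z hz
        simp only [hW, hz]
      have hWd : HasFDerivAt W (0 : ℂ →L[ℝ] ℝ) z₀ := by
        rw [← hcrit]
        refine DifferentiableAt.hasFDerivAt ?_
        have h3 : DifferentiableAt ℝ (fun z => ‖H z‖ ^ 2 / (ρ ^ 2 - ‖z‖ ^ 2)) z₀ := by
          have h4 : DifferentiableAt ℝ H z₀ := hHa.differentiableAt.restrictScalars ℝ
          have h5 : DifferentiableAt ℝ (fun z : ℂ => ρ ^ 2 - ‖z‖ ^ 2) z₀ :=
            (differentiableAt_const _).sub (differentiableAt_id.norm_sq ℝ)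
          simpa only [div_eq_mul_inv] using (h4.norm_sq ℝ).fun_mul (h5.fun_inv (hρ z₀ hz₀).ne')
        exact h3.congr_of_eventuallyEq hWH
      have hd := deriv_eq_of_critical hz₀ hHa hH0 hWH hWd
      filter_upwards [strict_min_of_second_order hz₀ hHa hH0 hd (hH hN0 H hHa hHq hd),
        nhdsWithin_le_nhds hWH] with z hz1 hz2
      rw [hz2, hWH.eq_of_nhds]
      exact hz1

namespace ExteriorUnivalence

/-- If `H ^ 2 = (α + β G) ^ 2 * k / G'`, then `H` solves a linear equation of second order whose
coefficients do not depend on `α`, `β`. -/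
theorem second_deriv_of_sq_eq {G k H : ℂ → ℂ} {z₀ α β : ℂ} (hG : AnalyticAt ℂ G z₀)
    (hG1 : deriv G z₀ ≠ 0) (hk : AnalyticAt ℂ k z₀) (hk0 : k z₀ ≠ 0)
    (hN0 : α + β * G z₀ ≠ 0) (hH : AnalyticAt ℂ H z₀)
    (hHq : ∀ z, H z ^ 2 = (α + β * G z) ^ 2 * (k z / deriv G z)) :
    deriv (deriv H) z₀ / H z₀ =
      -(1 / 2) * (schwarzian G z₀ - deriv (fun z => deriv k z / k z) z₀ +
        1 / 2 * (deriv k z₀ / k z₀) ^ 2) + deriv k z₀ / k z₀ * (deriv H z₀ / H z₀) := by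
  set l : ℂ → ℂ := fun z => deriv k z / k z with hl
  set P := preSchwarzian G with hP
  have hla : AnalyticAt ℂ l z₀ := hk.deriv.div hk hk0
  have hPa : AnalyticAt ℂ P z₀ := preSchwarzian_analyticAt hG hG1
  have hNa : AnalyticAt ℂ (fun z => α + β * G z) z₀ :=
    analyticAt_const.add (analyticAt_const.mul hG)
  -- This is the logarithmic derivative of H, so H''/H = y' + y². With u = βG'/(α + βG) one has u' =
  -- uP - u²; the u² and uP terms cancel, and what remains of u is absorbed in l·y.
  set y : ℂ → ℂ := fun z => β * deriv G z / (α + β * G z) + (1 / 2) * l z - (1 / 2) * P z with hy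
  have hne : ∀ z, α + β * G z ≠ 0 → k z ≠ 0 → deriv G z ≠ 0 → H z ≠ 0 := by
    intro z h1 h2 h3 h4
    have := hHq z
    rw [h4] at this
    simp [h1, h2, h3] at this
  have hH1 : deriv H =ᶠ[𝓝 z₀] fun z => H z * y z := by
    filter_upwards [hG.eventually_analyticAt, hk.eventually_analyticAt, hH.eventually_analyticAt,
      hG.deriv.continuousAt.eventually_ne hG1, hk.continuousAt.eventually_ne hk0,
      hNa.continuousAt.eventually_ne hN0] with z hGz hkz hHz hG1z hk0z hN0z
    have hH0z := hne z hN0z hk0z hG1z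
    have e1 := hHz.differentiableAt.hasDerivAt.pow 2
    have e2 : HasDerivAt (fun z => α + β * G z) (β * deriv G z) z :=
      (hGz.differentiableAt.hasDerivAt.const_mul β).const_add α
    have e3 := (e2.pow 2).mul (hkz.differentiableAt.hasDerivAt.div
      hGz.deriv.differentiableAt.hasDerivAt hG1z)
    have e4 := e1.unique (e3.congr_of_eventuallyEq (Eventually.of_forall fun w => by
      simpa using hHq w))
    have hq := hHq z
    simp at e4
    apply mul_left_cancel₀ (mul_ne_zero two_ne_zero hH0z)
    have hyz : y z = β * deriv G z / (α + β * G z) + (1 / 2) * (deriv k z / k z) -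
      (1 / 2) * (deriv (deriv G) z / deriv G z) := rfl
    rw [e4, show 2 * H z * (H z * y z) = 2 * y z * H z ^ 2 by ring, hq, hyz]
    field_simp
    ring
  have hN1 : HasDerivAt (fun z => β * deriv G z / (α + β * G z))
      ((β * deriv (deriv G) z₀ * (α + β * G z₀) - β * deriv G z₀ * (β * deriv G z₀)) /
        (α + β * G z₀) ^ 2) z₀ :=
    (hG.deriv.differentiableAt.hasDerivAt.const_mul β).div
      ((hG.differentiableAt.hasDerivAt.const_mul β).const_add α) hN0
  have hyd := (hN1.add (hla.differentiableAt.hasDerivAt.const_mul (1 / 2))).sub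
    (hPa.differentiableAt.hasDerivAt.const_mul (1 / 2))
  have hHy := (hH.differentiableAt.hasDerivAt.mul hyd).congr_of_eventuallyEq hH1
  have hH0 := hne z₀ hN0 hk0 hG1
  rw [hHy.deriv, hH1.eq_of_nhds, schwarzian_eq, ← hP]
  have hG2 : deriv (deriv G) z₀ = P z₀ * deriv G z₀ := by
    rw [hP, preSchwarzian]; field_simp
  have hl0 : deriv k z₀ / k z₀ = l z₀ := rfl
  rw [hG2, hl0]
  simp only [hy, Pi.add_apply, Pi.sub_apply]
  field_simp
  ring

/-! ### Extending the Schwarzian and the weight across poles. -/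

/-- The two kinds of charts: regular points, and simple poles. -/
theorem IsSphereChartAt.regular_or_pole {F : ℂ → ℂ} {z₀ : ℂ} (h : IsSphereChartAt F z₀) :
    (AnalyticAt ℂ F z₀ ∧ deriv F z₀ ≠ 0) ∨
      (¬ AnalyticAt ℂ F z₀ ∧ AnalyticAt ℂ F⁻¹ z₀ ∧ F⁻¹ z₀ = 0 ∧ deriv F⁻¹ z₀ ≠ 0 ∧
        ∀ᶠ z in 𝓝[≠] z₀, AnalyticAt ℂ F z ∧ AnalyticAt ℂ F⁻¹ z ∧ F⁻¹ z ≠ 0 ∧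
          deriv F⁻¹ z ≠ 0) := by
  refine h.imp_right fun ⟨ha, h0, h1⟩ => ?_
  have hne : ∀ᶠ z in 𝓝[≠] z₀, F⁻¹ z ≠ 0 :=
    ha.differentiableAt.hasDerivAt.eventually_ne h1
  refine ⟨fun hF => ?_, ha, h0, h1, ?_⟩
  · have hlim : Tendsto (fun z => F z * F⁻¹ z) (𝓝[≠] z₀) (𝓝 (F z₀ * F⁻¹ z₀)) :=
      ((hF.continuousAt.mul ha.continuousAt).tendsto).mono_left nhdsWithin_le_nhds
    have hone : (fun z => F z * F⁻¹ z) =ᶠ[𝓝[≠] z₀] fun _ => 1 := by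
      filter_upwards [hne] with z hz
      have hz' : F z ≠ 0 := fun h => hz (by simp [h])
      simp [hz']
    have := tendsto_nhds_unique (hlim.congr' hone) tendsto_const_nhds
    rw [h0, mul_zero] at this
    exact zero_ne_one this
  · filter_upwards [hne, nhdsWithin_le_nhds ha.eventually_analyticAt,
      nhdsWithin_le_nhds (ha.deriv.continuousAt.eventually_ne h1)] with z hz1 hz2 hz3
    refine ⟨?_, hz2, hz1, hz3⟩
    simpa using hz2.inv hz1

theorem IsSphereChartAt.eventually_analyticAt {F : ℂ → ℂ} {z₀ : ℂ} (h : IsSphereChartAt F z₀) :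
    ∀ᶠ z in 𝓝[≠] z₀, AnalyticAt ℂ F z := by
  rcases h.regular_or_pole with h | h
  · exact nhdsWithin_le_nhds h.1.eventually_analyticAt
  · exact h.2.2.2.2.mono fun z hz => hz.1

open Classical in
/-- The Schwarzian derivative, extended across simple poles. -/
noncomputable def sphereSchwarzian (F : ℂ → ℂ) (z : ℂ) : ℂ :=
  if AnalyticAt ℂ F z then schwarzian F z else schwarzian F⁻¹ z

open Classical in
/-- `‖p F + q‖ ^ 2 * ‖k / F'‖`, extended across simple poles of `F`. -/
noncomputable def sphereWeight (p q : ℂ) (F k : ℂ → ℂ) (z : ℂ) : ℝ :=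
  if AnalyticAt ℂ F z then ‖p * F z + q‖ ^ 2 * ‖k z / deriv F z‖
  else ‖p + q * F⁻¹ z‖ ^ 2 * ‖k z / deriv F⁻¹ z‖

theorem sphereWeight_nonneg (p q : ℂ) (F k : ℂ → ℂ) (z : ℂ) : 0 ≤ sphereWeight p q F k z := by
  unfold sphereWeight
  split_ifs <;> positivity

/-- For G = 1/F the factor G² in F' = -G'/G² clears the pole of (pF + q)², so the weight keeps its
shape with p and q exchanged. The last clause makes the zeros of a + bG simple. -/
theorem IsSphereChartAt.exists_chart {F : ℂ → ℂ} {z₀ : ℂ} (h : IsSphereChartAt F z₀)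
    {p q : ℂ} (hpq : p ≠ 0 ∨ q ≠ 0) :
    ∃ (G : ℂ → ℂ) (a b : ℂ), AnalyticAt ℂ G z₀ ∧ deriv G z₀ ≠ 0 ∧
      (sphereSchwarzian F =ᶠ[𝓝 z₀] schwarzian G) ∧
      (∀ k, sphereWeight p q F k =ᶠ[𝓝 z₀] fun z => ‖a + b * G z‖ ^ 2 * ‖k z / deriv G z‖) ∧
      (a + b * G z₀ = 0 → b ≠ 0) := by
  rcases h.regular_or_pole with ⟨ha, h1⟩ | ⟨hna, ha, h0, h1, hev⟩
  · refine ⟨F, q, p, ha, h1, ?_, fun k => ?_, ?_⟩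
    · filter_upwards [ha.eventually_analyticAt] with z hz
      simp [sphereSchwarzian, hz]
    · filter_upwards [ha.eventually_analyticAt] with z hz
      simp [sphereWeight, hz, add_comm]
    · rintro h2 rfl
      simp at h2
      simp [h2] at hpq
  · rw [eventually_nhdsWithin_iff] at hev
    refine ⟨F⁻¹, p, q, ha, h1, ?_, fun k => ?_, ?_⟩
    · filter_upwards [hev] with z hz
      by_cases hzz : z = z₀
      · rw [hzz, sphereSchwarzian, if_neg hna]
      · obtain ⟨hF, hFi, hz0, hz1⟩ := hz hzz
        rw [sphereSchwarzian, if_pos hF, ← schwarzian_inv hFi hz0 hz1, inv_inv]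
    · filter_upwards [hev] with z hz
      by_cases hzz : z = z₀
      · rw [hzz, sphereWeight, if_neg hna]
      · obtain ⟨hF, hFi, hz0, hz1⟩ := hz hzz
        rw [sphereWeight, if_pos hF]
        have hF0 : F z ≠ 0 := by
          intro h; apply hz0; simp [h]
        have hd : deriv F z = -deriv F⁻¹ z / (F⁻¹ z) ^ 2 := by
          have := (hFi.differentiableAt.hasDerivAt.inv hz0).deriv
          rwa [inv_inv] at this
        rw [hd]
        simp only [Pi.inv_apply]
        rw [← norm_pow, ← norm_pow, ← norm_mul, ← norm_mul, ← norm_neg]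
        congr 1
        field_simp
    · rintro h2 rfl
      rw [h0] at h2
      simp at h2
      simp [h2] at hpq

theorem IsSphereChartAt.analyticAt_sphereSchwarzian {F : ℂ → ℂ} {z₀ : ℂ}
    (h : IsSphereChartAt F z₀) : AnalyticAt ℂ (sphereSchwarzian F) z₀ := by
  obtain ⟨G, a, b, hG, hG1, hS, -, -⟩ := h.exists_chart (p := 1) (q := 0) (by simp)
  exact (schwarzian_analyticAt hG hG1).congr hS.symm

/-- A radius avoiding the moduli of a locally finite set. -/
theorem exists_radius_avoiding {P : ℂ → Prop}
    (hP : ∀ z, ‖z‖ < 1 → ∀ᶠ w in 𝓝[≠] z, ¬ P w) {r : ℝ} (hr : r < 1) :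
    ∃ ρ, r < ρ ∧ ρ < 1 ∧ ∀ z, ‖z‖ = ρ → ¬ P z := by
  obtain ⟨s, hrs, hs⟩ := exists_between hr
  have hfin : ({z | P z} ∩ Metric.closedBall (0 : ℂ) s).Finite := by
    refine (isCompact_closedBall (0 : ℂ) s).induction_on
      (p := fun t => ({z | P z} ∩ t).Finite) (by simp) ?_ ?_ ?_
    · intro t u htu hu
      exact hu.subset (Set.inter_subset_inter_right _ htu)
    · intro t u ht hu
      rw [Set.inter_union_distrib_left]
      exact ht.union hu
    · intro z hz
      rw [mem_closedBall_zero_iff] at hz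
      refine ⟨{w | w ≠ z → ¬ P w}, mem_nhdsWithin_of_mem_nhds
        (eventually_nhdsWithin_iff.1 (hP z (hz.trans_lt hs))), (Set.finite_singleton z).subset ?_⟩
      rintro w ⟨hw1, hw2⟩
      by_contra hwz
      exact hw2 hwz hw1
  obtain ⟨ρ, hρ, hρn⟩ := (Set.Ioo_infinite hrs).exists_notMem_finite (hfin.image norm)
  exact ⟨ρ, hρ.1, hρ.2.trans hs, fun z hz hPz =>
    hρn ⟨z, ⟨hPz, by simpa [hz] using hρ.2.le⟩, hz⟩⟩

/-! ### The univalence criterion in the unit disk. -/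

section Disk

variable {F k : ℂ → ℂ}

/-- The zeros of the weight form one fibre of F over the sphere. At a critical point H'/H = -z̄/d
turns the equation H'' = -½MH + lH' into the criterion for the disk of radius ρ. -/
theorem sphereWeight_zero_unique (hF : ∀ z, ‖z‖ < 1 → IsSphereChartAt F z)
    (hk : ∀ z, ‖z‖ < 1 → AnalyticAt ℂ k z ∧ k z ≠ 0)
    (h : ∀ z, ‖z‖ < 1 → ∀ᶠ w in 𝓝[≠] z,
      ‖(1 / 2 : ℂ) * ((1 - ‖w‖ ^ 2 : ℝ) : ℂ) ^ 2 *
          (sphereSchwarzian F w - deriv (fun z => deriv k z / k z) w +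
            1 / 2 * (deriv k w / k w) ^ 2) +
        ((1 - ‖w‖ ^ 2 : ℝ) : ℂ) * (starRingEnd ℂ) w * (deriv k w / k w)‖ ≤ 1)
    {p q : ℂ} (hpq : p ≠ 0 ∨ q ≠ 0) {z₁ z₂ : ℂ} (h₁ : ‖z₁‖ < 1) (h₂ : ‖z₂‖ < 1)
    (hz₁ : sphereWeight p q F k z₁ = 0) (hz₂ : sphereWeight p q F k z₂ = 0) : z₁ = z₂ := by
  set l : ℂ → ℂ := fun z => deriv k z / k z with hl
  set M : ℂ → ℂ := fun w => sphereSchwarzian F w - deriv l w + 1 / 2 * (l w) ^ 2 with hM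
  have hla : ∀ z, ‖z‖ < 1 → AnalyticAt ℂ l z := fun z hz =>
    (hk z hz).1.deriv.div (hk z hz).1 (hk z hz).2
  have hMa : ∀ z, ‖z‖ < 1 → AnalyticAt ℂ M z := fun z hz =>
    ((hF z hz).analyticAt_sphereSchwarzian.sub (hla z hz).deriv).add
      (analyticAt_const.mul ((hla z hz).pow 2))
  have hineq : ∀ z ∈ Metric.ball (0 : ℂ) 1,
      ‖(1 / 2 : ℂ) * ((1 - ‖z‖ ^ 2 : ℝ) : ℂ) ^ 2 * M z +
        ((1 - ‖z‖ ^ 2 : ℝ) : ℂ) * (starRingEnd ℂ) z * l z‖ ≤ 1 := by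
    intro z hz
    rw [mem_ball_zero_iff] at hz
    -- M and l are analytic throughout the disk, so the bound extends by continuity to the points
    -- left out of the hypothesis.
    have hc : ContinuousAt (fun z => ‖(1 / 2 : ℂ) * ((1 - ‖z‖ ^ 2 : ℝ) : ℂ) ^ 2 * M z +
        ((1 - ‖z‖ ^ 2 : ℝ) : ℂ) * (starRingEnd ℂ) z * l z‖) z := by
      have h1 := (hMa z hz).continuousAt
      have h2 := (hla z hz).continuousAt
      have h3 : Continuous (starRingEnd ℂ) := Complex.continuous_conj
      fun_prop
    exact le_of_tendsto (hc.tendsto.mono_left nhdsWithin_le_nhds) (h z hz)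
  have hchart : ∀ z₀, ‖z₀‖ < 1 → ∃ N E : ℂ → ℂ, AnalyticAt ℂ N z₀ ∧ AnalyticAt ℂ E z₀ ∧
      E z₀ ≠ 0 ∧ (sphereWeight p q F k =ᶠ[𝓝 z₀] fun z => ‖N z‖ ^ 2 * ‖E z‖) ∧
      (N z₀ = 0 → deriv N z₀ ≠ 0) ∧
      (N z₀ ≠ 0 → ∀ H : ℂ → ℂ, AnalyticAt ℂ H z₀ → (∀ z, H z ^ 2 = N z ^ 2 * E z) →
        deriv (deriv H) z₀ / H z₀ = -(1 / 2) * M z₀ + l z₀ * (deriv H z₀ / H z₀)) := by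
    intro z₀ hz₀
    obtain ⟨G, a, b, hG, hG1, hS, hV, hb⟩ := (hF z₀ hz₀).exists_chart hpq
    obtain ⟨hka, hk0⟩ := hk z₀ hz₀
    refine ⟨fun z => a + b * G z, fun z => k z / deriv G z,
      analyticAt_const.add (analyticAt_const.mul hG), hka.div hG.deriv hG1,
      div_ne_zero hk0 hG1, hV k, fun h0 => ?_, fun h0 H hH hHq => ?_⟩
    · rw [((hG.differentiableAt.hasDerivAt.const_mul b).const_add a).deriv]
      exact mul_ne_zero (hb h0) hG1
    · rw [second_deriv_of_sq_eq hG hG1 hka hk0 h0 hH hHq, hM]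
      beta_reduce
      rw [hS.eq_of_nhds]
  obtain ⟨ρ, hρ, hρ1, hsph⟩ := exists_radius_avoiding (P := fun z => sphereWeight p q F k z = 0)
    (fun z hz => by
      obtain ⟨N, E, hN, hE, hE0, hV, hN1, -⟩ := hchart z hz
      have hne : ∀ᶠ w in 𝓝[≠] z, N w ≠ 0 := by
        by_cases h0 : N z = 0
        · simpa [h0] using hN.differentiableAt.hasDerivAt.eventually_ne (hN1 h0) (c := 0)
        · exact nhdsWithin_le_nhds (hN.continuousAt.eventually_ne h0)
      filter_upwards [hne, nhdsWithin_le_nhds hV,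
        nhdsWithin_le_nhds (hE.continuousAt.eventually_ne hE0)] with w hw1 hw2 hw3
      rw [hw2]
      positivity) (max_lt h₁ h₂)
  refine zero_unique_of_second_order (ρ := ρ) (V := sphereWeight p q F k) ?_
    (sphereWeight_nonneg p q F k) hsph ?_ ((le_max_left _ _).trans_lt hρ)
    ((le_max_right _ _).trans_lt hρ) hz₁ hz₂
  · intro z hz
    rw [mem_closedBall_zero_iff] at hz
    obtain ⟨N, E, hN, hE, -, hV, -, -⟩ := hchart z (hz.trans_lt hρ1)
    have h1 : ContinuousAt (fun z => ‖N z‖ ^ 2 * ‖E z‖) z :=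
      (hN.continuousAt.norm.pow 2).mul hE.continuousAt.norm
    exact (h1.congr hV.symm).continuousWithinAt
  · intro z₀ hz₀
    obtain ⟨N, E, hN, hE, hE0, hV, hN1, hode⟩ := hchart z₀ (hz₀.trans hρ1)
    refine ⟨N, E, hN, hE, hE0, hV, hN1, fun h0 H hH hHq hcrit => ?_⟩
    have hH0 : H z₀ ≠ 0 := by
      intro h
      have := hHq z₀
      rw [h] at this
      simp [h0, hE0] at this
    have hd : 0 < ρ ^ 2 - ‖z₀‖ ^ 2 := by nlinarith [norm_nonneg z₀]
    have hdc : ((ρ ^ 2 - ‖z₀‖ ^ 2 : ℝ) : ℂ) ≠ 0 := by exact_mod_cast hd.ne'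
    have hfin := criterion_on_smaller_disk
      (fun z hz => (hMa z (by simpa using hz)).differentiableAt.differentiableWithinAt)
      (fun z hz => (hla z (by simpa using hz)).differentiableAt.differentiableWithinAt)
      hineq hρ1 hz₀
    have hnorm : (ρ ^ 2 - ‖z₀‖ ^ 2) ^ 2 = ‖((ρ ^ 2 - ‖z₀‖ ^ 2 : ℝ) : ℂ) ^ 2‖ := by
      rw [norm_pow, Complex.norm_real, Real.norm_of_nonneg hd.le]
    rw [hode h0 H hH hHq, hcrit, mul_div_cancel_right₀ _ hH0, hnorm, ← norm_mul, ← norm_neg]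
    refine lt_of_eq_of_lt (congrArg norm ?_) hfin
    field_simp
    ring

/-- Univalence criterion in the unit disk. -/
theorem univalent_in_disk (hF : ∀ z, ‖z‖ < 1 → IsSphereChartAt F z)
    (hk : ∀ z, ‖z‖ < 1 → AnalyticAt ℂ k z ∧ k z ≠ 0)
    (h : ∀ z, ‖z‖ < 1 → ∀ᶠ w in 𝓝[≠] z,
      ‖(1 / 2 : ℂ) * ((1 - ‖w‖ ^ 2 : ℝ) : ℂ) ^ 2 *
          (sphereSchwarzian F w - deriv (fun z => deriv k z / k z) w +
            1 / 2 * (deriv k w / k w) ^ 2) +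
        ((1 - ‖w‖ ^ 2 : ℝ) : ℂ) * (starRingEnd ℂ) w * (deriv k w / k w)‖ ≤ 1)
    {z₁ z₂ : ℂ} (h₁ : ‖z₁‖ < 1) (h₂ : ‖z₂‖ < 1)
    (heq : (AnalyticAt ℂ F z₁ ∧ AnalyticAt ℂ F z₂ ∧ F z₁ = F z₂) ∨
      (¬ AnalyticAt ℂ F z₁ ∧ ¬ AnalyticAt ℂ F z₂)) : z₁ = z₂ := by
  rcases heq with ⟨ha₁, ha₂, he⟩ | ⟨hn₁, hn₂⟩
  -- The fibre over the finite value c is cut out by F - c; the fibre over ∞ by p = 0, q = 1, that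
  -- is, by the zeros of `F⁻¹`.
  · refine sphereWeight_zero_unique hF hk h (p := 1) (q := -F z₁) (by simp) h₁ h₂ ?_ ?_
    · simp [sphereWeight, ha₁]
    · simp [sphereWeight, ha₂, he]
  · have hpole : ∀ z, ‖z‖ < 1 → ¬ AnalyticAt ℂ F z → F⁻¹ z = 0 := by
      intro z hz hn
      rcases (hF z hz).regular_or_pole with h | h
      · exact absurd h.1 hn
      · exact h.2.2.1
    refine sphereWeight_zero_unique hF hk h (p := 0) (q := 1) (by simp) h₁ h₂ ?_ ?_
    · rw [sphereWeight, if_neg hn₁, hpole _ h₁ hn₁]; simp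
    · rw [sphereWeight, if_neg hn₂, hpole _ h₂ hn₂]; simp

end Disk

/-! ### Transfer from the exterior to the disk. -/

theorem IsSphereChartAt.congr {F G : ℂ → ℂ} {z : ℂ} (h : IsSphereChartAt F z)
    (hFG : F =ᶠ[𝓝 z] G) : IsSphereChartAt G z := by
  refine h.imp (fun h => ⟨h.1.congr hFG, hFG.deriv_eq ▸ h.2⟩) fun h => ?_
  have hi := hFG.inv
  exact ⟨h.1.congr hi, hi.eq_of_nhds ▸ h.2.1, hi.deriv_eq ▸ h.2.2⟩

theorem IsSphereChartAt.comp_inv {f : ℂ → ℂ} {z : ℂ} (hz : z ≠ 0)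
    (h : IsSphereChartAt f z⁻¹) : IsSphereChartAt (fun w => f w⁻¹) z := by
  refine h.imp (fun h => ⟨analyticAt_comp_inv hz h.1, ?_⟩)
    fun h => ⟨analyticAt_comp_inv hz h.1, h.2.1, ?_⟩
  · rw [deriv_comp_inv hz h.1]
    exact div_ne_zero (neg_ne_zero.2 h.2) (pow_ne_zero 2 hz)
  · have h1 := deriv_comp_inv hz h.1
    rw [show (fun w => f w⁻¹)⁻¹ = fun w => f⁻¹ w⁻¹ from rfl, h1]
    exact div_ne_zero (neg_ne_zero.2 h.2.2) (pow_ne_zero 2 hz)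

theorem IsSphereChartAt.deriv_ne_zero {F : ℂ → ℂ} {z : ℂ} (h : IsSphereChartAt F z)
    (ha : AnalyticAt ℂ F z) : deriv F z ≠ 0 := by
  rcases h.regular_or_pole with h | h
  · exact h.2
  · exact absurd ha h.1

/-- The expression in the exterior criterion at `z⁻¹` in terms of the variable `z`. -/
theorem criterion_inversion {f g F k : ℂ → ℂ} {z : ℂ} (hz : z ≠ 0)
    (hf : AnalyticAt ℂ f z⁻¹) (hf1 : deriv f z⁻¹ ≠ 0)
    (hg : AnalyticAt ℂ g z⁻¹) (hg1 : deriv g z⁻¹ ≠ 0)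
    (hF : F =ᶠ[𝓝 z] fun w => f w⁻¹) (hk : k =ᶠ[𝓝 z] fun w => deriv g w⁻¹) :
    (1 / 2 : ℂ) * ((‖z⁻¹‖ : ℂ) ^ 2 - 1) ^ 2 * (z⁻¹ / (starRingEnd ℂ) z⁻¹) *
        (schwarzian f z⁻¹ - schwarzian g z⁻¹)
      - ((‖z⁻¹‖ : ℂ) ^ 2 - 1) * (z⁻¹ * deriv (deriv g) z⁻¹ / deriv g z⁻¹) =
    z / (starRingEnd ℂ) z * ((1 / 2 : ℂ) * ((1 - ‖z‖ ^ 2 : ℝ) : ℂ) ^ 2 *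
          (sphereSchwarzian F z - deriv (fun z => deriv k z / k z) z +
            1 / 2 * (deriv k z / k z) ^ 2) +
        ((1 - ‖z‖ ^ 2 : ℝ) : ℂ) * (starRingEnd ℂ) z * (deriv k z / k z)) := by
  set l : ℂ → ℂ := fun z => deriv k z / k z with hl
  have hFa : AnalyticAt ℂ F z := (analyticAt_comp_inv hz hf).congr hF.symm
  have hka : AnalyticAt ℂ k z := (analyticAt_comp_inv hz hg.deriv).congr hk.symm
  have hk0 : k z ≠ 0 := by rw [hk.eq_of_nhds]; exact hg1
  have hla : AnalyticAt ℂ l z := hka.deriv.div hka hk0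
  have hSF : sphereSchwarzian F z = schwarzian f z⁻¹ / z ^ 4 := by
    rw [sphereSchwarzian, if_pos hFa, schwarzian_congr hF, schwarzian_comp_inv hz hf hf1]
  have hP : (fun w => preSchwarzian g w⁻¹) =ᶠ[𝓝 z] fun w => -(w ^ 2 * l w) := by
    filter_upwards [hk.deriv, hk, eventually_comp_inv hz hg] with w hw1 hw2 hw3
    have : w ≠ 0 := hw3.1
    simp only [hl]
    rw [hw1, hw2, deriv_comp_inv hw3.1 hw3.2.deriv, preSchwarzian]
    generalize deriv g w⁻¹ = x
    generalize deriv (deriv g) w⁻¹ = y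
    field_simp
  have hPa := preSchwarzian_analyticAt hg hg1
  have h2 : HasDerivAt (fun w => -(w ^ 2 * l w)) (-(2 * z * l z + z ^ 2 * deriv l z)) z := by
    refine (((hasDerivAt_id z).pow 2).mul hla.differentiableAt.hasDerivAt).neg.congr_deriv ?_
    simp
  have hP' : deriv (preSchwarzian g) z⁻¹ = z ^ 2 * (2 * z * l z + z ^ 2 * deriv l z) := by
    have h1 := deriv_comp_inv hz hPa
    rw [hP.deriv_eq, h2.deriv] at h1
    generalize deriv (preSchwarzian g) z⁻¹ = D at h1 ⊢
    field_simp at h1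
    linear_combination h1
  have hPz : preSchwarzian g z⁻¹ = -(z ^ 2 * l z) := hP.eq_of_nhds
  -- With r = |z|², the term 2z³l contributes -(1-r)²l/z̄ and the g''/g' term contributes (1-r)l/z̄;
  -- their sum is (1-r)z l, the last term of the disk criterion.
  have hSg : schwarzian g z⁻¹ = z ^ 4 * (deriv l z - 1 / 2 * l z ^ 2) + 2 * z ^ 3 * l z := by
    rw [schwarzian_eq, hP', hPz]; ring
  have hlz : deriv k z / k z = l z := rfl
  have hSf : schwarzian f z⁻¹ = z ^ 4 * sphereSchwarzian F z := by
    rw [hSF]; field_simp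
  have hgg : z⁻¹ * deriv (deriv g) z⁻¹ / deriv g z⁻¹ = z⁻¹ * -(z ^ 2 * l z) := by
    rw [mul_div_assoc, ← hPz, preSchwarzian]
  have hc0 : (starRingEnd ℂ) z ≠ 0 := by simpa using hz
  have hr : (‖z‖ : ℂ) ^ 2 = z * (starRingEnd ℂ) z := (Complex.mul_conj' z).symm
  rw [hgg, hSf, hSg, hlz, map_inv₀, norm_inv, Complex.ofReal_inv, inv_pow, hr]
  push_cast
  rw [hr]
  generalize sphereSchwarzian F z = T
  generalize (starRingEnd ℂ) z = c at *
  generalize deriv l z = l'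
  field_simp
  ring

/-! ### Behaviour at the origin and at poles of g. -/

/-- Logarithmic derivative at a zero of finite order. -/
theorem exists_logDeriv_expansion {k : ℂ → ℂ} (hk : AnalyticAt ℂ k 0)
    (hne : ∀ᶠ z in 𝓝[≠] (0 : ℂ), k z ≠ 0) :
    ∃ (n : ℕ) (B : ℂ → ℂ), AnalyticAt ℂ B 0 ∧ B 0 = n ∧
      (∀ᶠ z in 𝓝[≠] (0 : ℂ), deriv k z / k z = B z / z) ∧
      (n = 0 → k 0 ≠ 0) ∧ (n = 1 → deriv k 0 ≠ 0) := by
  have hnz : ¬ ∀ᶠ z in 𝓝 (0 : ℂ), k z = 0 := fun h => by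
    obtain ⟨z, h1, h2⟩ := ((h.filter_mono nhdsWithin_le_nhds).and hne).exists
    exact h2 h1
  obtain ⟨n, e, he, he0, hke⟩ := (hk.exists_eventuallyEq_pow_smul_nonzero_iff).2 hnz
  have hke' : k =ᶠ[𝓝 0] fun z => z ^ n * e z :=
    hke.mono fun z hz => by simpa using hz
  refine ⟨n, fun z => n + z * (deriv e z / e z),
    analyticAt_const.add (analyticAt_id.mul (he.deriv.div he he0)), by simp, ?_, ?_, ?_⟩
  · filter_upwards [nhdsWithin_le_nhds hke'.deriv, nhdsWithin_le_nhds hke',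
      nhdsWithin_le_nhds he.eventually_analyticAt,
      nhdsWithin_le_nhds (he.continuousAt.eventually_ne he0), self_mem_nhdsWithin]
      with z hz1 hz2 hz3 hz4 hz5
    have hz0 : z ≠ 0 := hz5
    have hd : HasDerivAt (fun z => z ^ n * e z) (n * z ^ (n - 1) * e z + z ^ n * deriv e z) z :=
      (hasDerivAt_pow n z).mul hz3.differentiableAt.hasDerivAt
    rw [hz1, hz2, hd.deriv]
    rcases n with _ | n
    · simp
      field_simp
    · simp only [Nat.add_sub_cancel]
      field_simp
      ring
  · rintro rfl
    rw [hke'.eq_of_nhds]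
    simpa using he0
  · rintro rfl
    have hd : HasDerivAt (fun z => z ^ 1 * e z) (e 0) 0 := by
      refine ((hasDerivAt_pow 1 (0 : ℂ)).mul he.differentiableAt.hasDerivAt).congr_deriv ?_
      simp
    rw [hke'.deriv_eq, hd.deriv]
    exact he0

/-- If `l = B / z` near `0` then `l' - l ^ 2 / 2` has at most a double pole. -/
theorem schwarzian_expansion_of_simple_pole {l B : ℂ → ℂ} (hB : AnalyticAt ℂ B 0)
    (h : ∀ᶠ z in 𝓝[≠] (0 : ℂ), l z = B z / z) :
    ∀ᶠ z in 𝓝[≠] (0 : ℂ), z ^ 2 * (deriv l z - 1 / 2 * l z ^ 2) =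
      z * deriv B z - B z - 1 / 2 * B z ^ 2 := by
  rw [← eventually_eventually_nhdsWithin] at h
  filter_upwards [h, nhdsWithin_le_nhds hB.eventually_analyticAt, self_mem_nhdsWithin]
    with z hz1 hz2 hz3
  have hz0 : z ≠ 0 := hz3
  rw [isOpen_compl_singleton.nhdsWithin_eq hz3] at hz1
  have hl : l =ᶠ[𝓝 z] fun z => B z / z := hz1
  have hd : HasDerivAt (fun z => B z / z) ((deriv B z * z - B z * 1) / z ^ 2) z :=
    hz2.differentiableAt.hasDerivAt.div (hasDerivAt_id z) hz0
  rw [hl.deriv_eq, hd.deriv, hl.eq_of_nhds]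
  field_simp

/-- A function satisfying the hypotheses of the criterion has no poles, by the singularity of
`g'' / g'`. -/
theorem analyticAt_of_criterion {f g : ℂ → ℂ} {ζ₀ : ℂ} (h1 : 1 < ‖ζ₀‖)
    (hf : IsSphereChartAt f ζ₀) (hg : IsSphereChartAt g ζ₀)
    (hineq : ∀ᶠ ζ in 𝓝[≠] ζ₀, AnalyticAt ℂ f ζ → AnalyticAt ℂ g ζ →
      ‖(1 / 2 : ℂ) * ((‖ζ‖ : ℂ) ^ 2 - 1) ^ 2 * (ζ / (starRingEnd ℂ) ζ) *
            (schwarzian f ζ - schwarzian g ζ)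
          - ((‖ζ‖ : ℂ) ^ 2 - 1) * (ζ * deriv (deriv g) ζ / deriv g ζ)‖ ≤ 1) :
    AnalyticAt ℂ g ζ₀ := by
  by_contra hna
  rcases hg.regular_or_pole with h | ⟨-, ha, h0, hd, hev⟩
  · exact hna h.1
  have hζ0 : ζ₀ ≠ 0 := by
    rintro rfl
    simp at h1
    linarith
  have hcf := hf.analyticAt_sphereSchwarzian.continuousAt
  have hcg := hg.analyticAt_sphereSchwarzian.continuousAt
  have hcP := (preSchwarzian_analyticAt ha hd).continuousAt
  have hcd := ha.deriv.continuousAt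
  have hcG := ha.continuousAt
  set X : ℂ → ℂ := fun ζ => (1 / 2 : ℂ) * ((‖ζ‖ : ℂ) ^ 2 - 1) ^ 2 * (ζ / (starRingEnd ℂ) ζ) *
    (sphereSchwarzian f ζ - sphereSchwarzian g ζ) with hX
  have hcX : ContinuousAt X ζ₀ := by
    have h3 : Continuous (starRingEnd ℂ) := Complex.continuous_conj
    have h4 : (starRingEnd ℂ) ζ₀ ≠ 0 := by simpa using hζ0
    have h5 : ContinuousAt (fun ζ => ζ / (starRingEnd ℂ) ζ) ζ₀ :=
      continuousAt_id.div h3.continuousAt h4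
    fun_prop
  -- The inequality is multiplied by `g⁻¹` to remove the pole of g''/g'. In the limit the right side
  -- vanishes, while the left tends to 2(‖ζ₀‖² - 1)‖ζ₀‖‖(1/g)'(ζ₀)‖ ≠ 0.
  have hle : ∀ᶠ ζ in 𝓝[≠] ζ₀, ‖((‖ζ‖ : ℂ) ^ 2 - 1) * ζ *
      (g⁻¹ ζ * preSchwarzian g⁻¹ ζ - 2 * deriv g⁻¹ ζ)‖ ≤ ‖g⁻¹ ζ‖ * (1 + ‖X ζ‖) := by
    filter_upwards [hev, hf.eventually_analyticAt, hineq] with ζ hζ hfa hin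
    obtain ⟨hga, hgi, hg0, hg1⟩ := hζ
    have h2 := hin hfa hga
    have hpre := preSchwarzian_inv hgi hg0 hg1
    rw [inv_inv] at hpre
    have e1 : schwarzian f ζ = sphereSchwarzian f ζ := by rw [sphereSchwarzian, if_pos hfa]
    have e2 : schwarzian g ζ = sphereSchwarzian g ζ := by rw [sphereSchwarzian, if_pos hga]
    have e3 : ζ * deriv (deriv g) ζ / deriv g ζ = ζ * preSchwarzian g ζ := by
      rw [mul_div_assoc, preSchwarzian]
    rw [e1, e2, e3] at h2
    have e4 : ((‖ζ‖ : ℂ) ^ 2 - 1) * ζ * (g⁻¹ ζ * preSchwarzian g⁻¹ ζ - 2 * deriv g⁻¹ ζ) =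
        g⁻¹ ζ * (((‖ζ‖ : ℂ) ^ 2 - 1) * (ζ * preSchwarzian g ζ)) := by
      rw [hpre]
      field_simp
    rw [e4, norm_mul]
    gcongr
    have h5 := norm_sub_norm_le (((‖ζ‖ : ℂ) ^ 2 - 1) * (ζ * preSchwarzian g ζ)) (X ζ)
    rw [norm_sub_rev] at h5
    linarith
  have hl : ContinuousAt (fun ζ => ‖((‖ζ‖ : ℂ) ^ 2 - 1) * ζ *
      (g⁻¹ ζ * preSchwarzian g⁻¹ ζ - 2 * deriv g⁻¹ ζ)‖) ζ₀ := by fun_prop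
  have hr : ContinuousAt (fun ζ => ‖g⁻¹ ζ‖ * (1 + ‖X ζ‖)) ζ₀ := by fun_prop
  have hlim := le_of_tendsto_of_tendsto (hl.tendsto.mono_left nhdsWithin_le_nhds)
    (hr.tendsto.mono_left nhdsWithin_le_nhds) hle
  rw [h0] at hlim
  simp only [zero_mul, zero_sub, norm_zero, norm_le_zero_iff, mul_eq_zero, neg_eq_zero] at hlim
  rcases hlim with (h | h) | h | h
  · have h6 : ((‖ζ₀‖ ^ 2 - 1 : ℝ) : ℂ) = 0 := by push_cast; exact h
    have : ‖ζ₀‖ ^ 2 - 1 = 0 := by exact_mod_cast h6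
    nlinarith
  · exact hζ0 h
  · norm_num at h
  · exact hd h

theorem inv_mem_exteriorDisk {z : ℂ} (hz0 : z ≠ 0) (hz : ‖z‖ < 1) : z⁻¹ ∈ exteriorDisk := by
  simp only [exteriorDisk, Set.mem_ofPred_eq, norm_inv]
  exact one_lt_inv_iff₀.2 ⟨norm_pos_iff.2 hz0, hz⟩

theorem ClassSigma.isSphereChartAt {f : ℂ → ℂ} (hf : ClassSigma f)
    (hloc : LocallyUnivalentOn f exteriorDisk) {ζ : ℂ} (hζ : ζ ∈ exteriorDisk) :
    IsSphereChartAt f ζ := by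
  obtain ⟨V, hV, hinj⟩ := hloc ζ hζ
  exact isSphereChartAt_of_univalentOn (hf.1 hζ) hV hinj

/-- The function `z ↦ f (1 / z)` near `0`, and its Schwarzian derivative there. -/
theorem exists_sphereSchwarzian_expansion {f : ℂ → ℂ} (hf : ClassSigma f)
    (hloc : LocallyUnivalentOn f exteriorDisk) :
    ∃ (F : ℂ → ℂ) (n : ℕ) (A : ℂ → ℂ), (∀ z ≠ 0, F z = f z⁻¹) ∧ AnalyticAt ℂ A 0 ∧
      A 0 = -n - 1 / 2 * n ^ 2 ∧ (∀ᶠ z in 𝓝[≠] (0 : ℂ), z ^ 2 * sphereSchwarzian F z = A z) ∧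
      (∀ᶠ z in 𝓝[≠] (0 : ℂ), AnalyticAt ℂ F z) ∧ (n = 0 → IsSphereChartAt F 0) := by
  obtain ⟨hnf, b, φ, hφ, hexp⟩ := hf
  have hexp0 : ∀ᶠ z in 𝓝[≠] (0 : ℂ), f z⁻¹ = b * z⁻¹ + φ z := by
    simpa using tendsto_inv₀_nhdsNE_zero.eventually hexp
  have hsmall : ∀ᶠ z in 𝓝[≠] (0 : ℂ), z ≠ 0 ∧ ‖z‖ < 1 :=
    (eventually_nhdsWithin_of_forall fun z hz => hz).and
      (nhdsWithin_le_nhds ((isOpen_lt continuous_norm continuous_const).mem_nhds (by simp)))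
  -- If b = 0, F is analytic at 0 and n is the order of F' there. If b ≠ 0, F has a simple pole,
  -- already a sphere chart, and n = 0.
  by_cases hb : b = 0
  · subst hb
    set F := Function.update (fun z => f z⁻¹) 0 (φ 0) with hFdef
    have hFne : ∀ z ≠ 0, F z = f z⁻¹ := fun z hz => by simp [hFdef, hz]
    have hFφ : φ =ᶠ[𝓝 0] F := by
      rw [eventually_nhdsWithin_iff] at hexp0
      filter_upwards [hexp0] with z hz
      by_cases h0 : z = 0
      · simp [hFdef, h0]
      · rw [hFne z h0, hz h0]; simp
    have hFa : AnalyticAt ℂ F 0 := hφ.congr hFφ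
    have hd : ∀ᶠ z in 𝓝[≠] (0 : ℂ), AnalyticAt ℂ F z ∧ deriv F z ≠ 0 := by
      filter_upwards [hsmall, nhdsWithin_le_nhds hFa.eventually_analyticAt] with z hz hza
      refine ⟨hza, IsSphereChartAt.deriv_ne_zero ?_ hza⟩
      refine (IsSphereChartAt.comp_inv hz.1 (ClassSigma.isSphereChartAt ⟨hnf, 0, φ, hφ, hexp⟩ hloc
        (inv_mem_exteriorDisk hz.1 hz.2))).congr ?_
      filter_upwards [eventually_ne_nhds hz.1] with w hw
      exact (hFne w hw).symm
    obtain ⟨n, B, hB, hB0, hBe, hn0, -⟩ := exists_logDeriv_expansion hFa.deriv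
      (hd.mono fun z hz => hz.2)
    refine ⟨F, n, fun z => z * deriv B z - B z - 1 / 2 * B z ^ 2, hFne,
      ((analyticAt_id.mul hB.deriv).sub hB).sub (analyticAt_const.mul (hB.pow 2)), ?_, ?_,
      hd.mono fun z hz => hz.1, fun hn => Or.inl ⟨hFa, hn0 hn⟩⟩
    · simp [hB0]
    · filter_upwards [schwarzian_expansion_of_simple_pole hB hBe, hd] with z hz1 hz2
      rw [sphereSchwarzian, if_pos hz2.1, ← hz1]
      rfl
  -- The value 0 at the pole makes `F⁻¹` vanish at 0, since 0⁻¹ = 0, as a chart at a pole requires.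
  · set F := Function.update (fun z => f z⁻¹) 0 0 with hFdef
    have hFne : ∀ z ≠ 0, F z = f z⁻¹ := fun z hz => by simp [hFdef, hz]
    have hden : AnalyticAt ℂ (fun z => b + z * φ z) 0 :=
      analyticAt_const.add (analyticAt_id.mul hφ)
    have hden0 : b + 0 * φ 0 ≠ 0 := by simpa using hb
    have hFi : (fun z => z / (b + z * φ z)) =ᶠ[𝓝 0] F⁻¹ := by
      rw [eventually_nhdsWithin_iff] at hexp0
      filter_upwards [hexp0, hden.continuousAt.eventually_ne hden0] with z hz hz2
      by_cases h0 : z = 0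
      · simp [hFdef, h0]
      · rw [Pi.inv_apply, hFne z h0, hz h0]
        have : b * z⁻¹ + φ z = (b + z * φ z) / z := by field_simp
        rw [this, inv_div]
    have hchart : IsSphereChartAt F 0 := by
      refine Or.inr ⟨(analyticAt_id.div hden hden0).congr hFi, by simp [hFdef], ?_⟩
      rw [← hFi.deriv_eq]
      have hd := (hasDerivAt_id (0 : ℂ)).div hden.differentiableAt.hasDerivAt hden0
      have hd' : HasDerivAt (fun z => z / (b + z * φ z)) b⁻¹ 0 := by
        refine hd.congr_deriv ?_
        simp
        field_simp
      rw [hd'.deriv]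
      exact inv_ne_zero hb
    refine ⟨F, 0, fun z => z ^ 2 * sphereSchwarzian F z, hFne,
      (analyticAt_id.pow 2).mul hchart.analyticAt_sphereSchwarzian, by simp, by simp,
      hchart.eventually_analyticAt, fun _ => hchart⟩

/-- The function `z ↦ g' (1 / z)` near `0`. -/
theorem exists_deriv_comp_inv_extension {g : ℂ → ℂ} (hg : ClassSigma g) :
    ∃ k : ℂ → ℂ, (∀ z ≠ 0, k z = deriv g z⁻¹) ∧ AnalyticAt ℂ k 0 ∧ deriv k 0 = 0 := by
  obtain ⟨-, b, φ, hφ, hexp⟩ := hg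
  -- In the variable z this is k = b - z²φ', which has no linear term; hence k cannot have a simple
  -- zero at 0.
  have hexp0 : ∀ᶠ ζ in cobounded ℂ, deriv g ζ = b - ζ⁻¹ ^ 2 * deriv φ ζ⁻¹ := by
    have h1 : ∀ᶠ ζ in cobounded ℂ, AnalyticAt ℂ φ ζ⁻¹ :=
      (tendsto_inv₀_cobounded (α := ℂ)).eventually hφ.eventually_analyticAt
    obtain ⟨R, -, hR⟩ := (Metric.hasBasis_cobounded_compl_closedBall (0 : ℂ)).eventually_iff.1 hexp
    filter_upwards [h1, (Metric.hasBasis_cobounded_compl_closedBall (0 : ℂ)).mem_of_mem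
      (i := max R 0) trivial] with ζ hζ hζR
    simp only [Set.mem_compl_iff, mem_closedBall_zero_iff, not_le, max_lt_iff] at hζR
    have hζ0 : ζ ≠ 0 := norm_pos_iff.1 hζR.2
    have heq : g =ᶠ[𝓝 ζ] fun ζ => b * ζ + φ ζ⁻¹ := by
      filter_upwards [(isOpen_lt continuous_const continuous_norm).mem_nhds hζR.1] with w hw
      exact hR (by simpa using hw)
    have hd := ((hasDerivAt_id ζ).const_mul b).add
      (analyticAt_comp_inv hζ0 hζ).differentiableAt.hasDerivAt
    rw [heq.deriv_eq]
    refine hd.deriv.trans ?_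
    rw [deriv_comp_inv hζ0 hζ]
    field_simp
    ring
  have hexp1 : ∀ᶠ z in 𝓝[≠] (0 : ℂ), deriv g z⁻¹ = b - z ^ 2 * deriv φ z := by
    simpa using tendsto_inv₀_nhdsNE_zero.eventually hexp0
  set k := Function.update (fun z => deriv g z⁻¹) 0 b with hk
  have hkne : ∀ z ≠ 0, k z = deriv g z⁻¹ := fun z hz => by simp [hk, hz]
  have hke : (fun z => b - z ^ 2 * deriv φ z) =ᶠ[𝓝 0] k := by
    rw [eventually_nhdsWithin_iff] at hexp1
    filter_upwards [hexp1] with z hz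
    by_cases h0 : z = 0
    · simp [hk, h0]
    · rw [hkne z h0, hz h0]
  refine ⟨k, hkne, (analyticAt_const.sub ((analyticAt_id.pow 2).mul hφ.deriv)).congr hke, ?_⟩
  have hd : HasDerivAt (fun z => b - z ^ 2 * deriv φ z) 0 0 := by
    refine (((hasDerivAt_pow 2 (0 : ℂ)).mul
      hφ.deriv.differentiableAt.hasDerivAt).const_sub b).congr_deriv ?_
    simp
  rw [← hke.deriv_eq, hd.deriv]

end ExteriorUnivalence

/-! ### Proof of the theorem. -/

open ExteriorUnivalence in
/-- In the inequality `ζ` runs over the points of `U*` at which neither `f` nor `g` has a pole. -/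
theorem corollaryc3 (f g : ℂ → ℂ)
    (hf : ExteriorUnivalence.ClassSigma f) (hg : ExteriorUnivalence.ClassSigma g)
    (hf_loc : ExteriorUnivalence.LocallyUnivalentOn f ExteriorUnivalence.exteriorDisk)
    (hg_loc : ExteriorUnivalence.LocallyUnivalentOn g ExteriorUnivalence.exteriorDisk)
    (hineq : ∀ ζ ∈ ExteriorUnivalence.exteriorDisk, AnalyticAt ℂ f ζ → AnalyticAt ℂ g ζ →
      ‖(1 / 2 : ℂ) * ((‖ζ‖ : ℂ) ^ 2 - 1) ^ 2 * (ζ / (starRingEnd ℂ) ζ) *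
            (ExteriorUnivalence.schwarzian f ζ - ExteriorUnivalence.schwarzian g ζ)
          - ((‖ζ‖ : ℂ) ^ 2 - 1) * (ζ * deriv (deriv g) ζ / deriv g ζ)‖ ≤ 1) :
    ExteriorUnivalence.UnivalentOn f ExteriorUnivalence.exteriorDisk := by
  have hfc : ∀ ζ ∈ exteriorDisk, IsSphereChartAt f ζ := fun ζ hζ => hf.isSphereChartAt hf_loc hζ
  have hgc : ∀ ζ ∈ exteriorDisk, IsSphereChartAt g ζ := fun ζ hζ => hg.isSphereChartAt hg_loc hζ
  have hopen : IsOpen exteriorDisk := isOpen_lt continuous_const continuous_norm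
  have hga : ∀ ζ ∈ exteriorDisk, AnalyticAt ℂ g ζ := fun ζ hζ =>
    analyticAt_of_criterion hζ (hfc ζ hζ) (hgc ζ hζ)
      (nhdsWithin_le_nhds (Filter.mem_of_superset (hopen.mem_nhds hζ) fun w hw => hineq w hw))
  have hg1 : ∀ ζ ∈ exteriorDisk, deriv g ζ ≠ 0 := fun ζ hζ =>
    (hgc ζ hζ).deriv_ne_zero (hga ζ hζ)
  obtain ⟨F, n, A, hFne, hA, hA0, hAe, hFa0, hn⟩ := exists_sphereSchwarzian_expansion hf hf_loc
  obtain ⟨k, hkne, hka, hk1⟩ := exists_deriv_comp_inv_extension hg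
  have hFe : ∀ z ≠ 0, F =ᶠ[𝓝 z] fun w => f w⁻¹ := fun z hz =>
    (eventually_ne_nhds hz).mono hFne
  have hke : ∀ z ≠ 0, k =ᶠ[𝓝 z] fun w => deriv g w⁻¹ := fun z hz =>
    (eventually_ne_nhds hz).mono hkne
  have hFc : ∀ z ≠ 0, ‖z‖ < 1 → IsSphereChartAt F z := fun z hz hz1 =>
    (IsSphereChartAt.comp_inv hz (hfc _ (inv_mem_exteriorDisk hz hz1))).congr (hFe z hz).symm
  have hkd : ∀ z ≠ 0, ‖z‖ < 1 → AnalyticAt ℂ k z ∧ k z ≠ 0 := fun z hz hz1 =>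
    ⟨(analyticAt_comp_inv hz (hga _ (inv_mem_exteriorDisk hz hz1)).deriv).congr (hke z hz).symm,
      hkne z hz ▸ hg1 _ (inv_mem_exteriorDisk hz hz1)⟩
  have hsmall : ∀ z : ℂ, ‖z‖ < 1 → ∀ᶠ w in 𝓝[≠] z, w ≠ 0 ∧ ‖w‖ < 1 := by
    intro z hz
    refine Filter.Eventually.and ?_ (nhdsWithin_le_nhds
      ((isOpen_lt continuous_norm continuous_const).mem_nhds hz))
    by_cases h0 : z = 0
    · rw [h0]; exact self_mem_nhdsWithin
    · exact nhdsWithin_le_nhds (eventually_ne_nhds h0)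
  have hFf : ∀ z ≠ 0, (AnalyticAt ℂ F z ↔ AnalyticAt ℂ f z⁻¹) := by
    intro z hz
    rw [analyticAt_congr (hFe z hz)]
    refine ⟨fun h => ?_, analyticAt_comp_inv hz⟩
    have := analyticAt_comp_inv (f := fun w => f w⁻¹) (inv_ne_zero hz) (by rwa [inv_inv])
    simpa using this
  have hcrit : ∀ z ≠ 0, ‖z‖ < 1 → AnalyticAt ℂ F z →
      ‖(1 / 2 : ℂ) * ((1 - ‖z‖ ^ 2 : ℝ) : ℂ) ^ 2 *
          (sphereSchwarzian F z - deriv (fun z => deriv k z / k z) z +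
            1 / 2 * (deriv k z / k z) ^ 2) +
        ((1 - ‖z‖ ^ 2 : ℝ) : ℂ) * (starRingEnd ℂ) z * (deriv k z / k z)‖ ≤ 1 := by
    intro z hz hz1 hFa
    have hmem := inv_mem_exteriorDisk hz hz1
    have hfa := (hFf z hz).1 hFa
    have h1 := hineq _ hmem hfa (hga _ hmem)
    rw [criterion_inversion hz hfa ((hfc _ hmem).deriv_ne_zero hfa) (hga _ hmem) (hg1 _ hmem)
      (hFe z hz) (hke z hz), norm_mul, norm_div, RCLike.norm_conj,
      div_self (norm_ne_zero_iff.2 hz), one_mul] at h1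
    exact h1
  have hker : ∀ z ≠ 0, z / (starRingEnd ℂ) z = z ^ 2 / (‖z‖ : ℂ) ^ 2 := by
    intro z hz
    have hc0 : (starRingEnd ℂ) z ≠ 0 := by simpa using hz
    rw [← Complex.mul_conj' z]
    field_simp
  have hk_ne : ∀ᶠ z in 𝓝[≠] (0 : ℂ), k z ≠ 0 :=
    (hsmall 0 (by simp)).mono fun z hz => (hkd z hz.1 hz.2).2
  obtain ⟨j, B, hB, hB0, hBe, hj0, hj1⟩ := exists_logDeriv_expansion hka hk_ne
  -- Multiplying the criterion by the unimodular z²/‖z‖² clears the possible double poles and turns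
  -- z̄ l into z l = B. With j the order of k at 0, the conclusion reads n + n²/2 = j + j²/2 and j ≤
  -- 1; j = 1 is impossible because k'(0) = 0, so j = n = 0.
  have hlead := leading_coefficients_of_criterion
    (A := fun z => A z - (z * deriv B z - B z - 1 / 2 * B z ^ 2))
    (hA.sub (((analyticAt_id.mul hB.deriv).sub hB).sub (analyticAt_const.mul (hB.pow 2)))) hB (by
      filter_upwards [hsmall 0 (by simp), hFa0, hAe, hBe,
        schwarzian_expansion_of_simple_pole hB hBe] with z hz hFa hAz hBz hSz
      have h1 := hcrit z hz.1 hz.2 hFa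
      have hz0 : z ≠ 0 := hz.1
      have hc0 : (starRingEnd ℂ) z ≠ 0 := by simpa using hz0
      have hnc : (‖z‖ : ℂ) ≠ 0 := by simpa using hz0
      have hn1 : ‖z ^ 2 / (‖z‖ : ℂ) ^ 2‖ = 1 := by
        rw [← hker z hz0, norm_div, RCLike.norm_conj, div_self (norm_ne_zero_iff.2 hz0)]
      have hBz' : B z = z * (deriv k z / k z) := by rw [hBz]; field_simp
      have hcz : z ^ 2 / (‖z‖ : ℂ) ^ 2 * (starRingEnd ℂ) z = z := by
        rw [← hker z hz0]; field_simp
      have h2 := mul_le_mul_of_nonneg_left h1 (norm_nonneg (z ^ 2 / (‖z‖ : ℂ) ^ 2))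
      rw [← norm_mul, hn1, one_mul] at h2
      refine (congrArg norm ?_).trans_le h2
      rw [← hAz, ← hSz, hBz']
      linear_combination (-(((1 - ‖z‖ ^ 2 : ℝ) : ℂ)) * (deriv k z / k z)) * hcz)
  have hj : j = 0 := by
    have h1 : ‖(j : ℂ)‖ ≤ 1 := hB0 ▸ hlead.2
    rw [Complex.norm_natCast] at h1
    have h2 : j ≤ 1 := by exact_mod_cast h1
    have h3 : j ≠ 1 := fun h => hj1 h hk1
    omega
  have hn0 : n = 0 := by
    have h1 := hlead.1
    simp only [hA0, hB0, hj] at h1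
    have h2 : ((n : ℝ) + 1 / 2 * (n : ℝ) ^ 2 : ℝ) = 0 := by
      rw [← Complex.ofReal_eq_zero]
      push_cast at h1 ⊢
      linear_combination -h1
    have h4 : (0 : ℝ) ≤ n := n.cast_nonneg
    have h5 : (n : ℝ) = 0 := by nlinarith
    exact_mod_cast h5
  have hFc' : ∀ z, ‖z‖ < 1 → IsSphereChartAt F z := by
    intro z hz
    by_cases h0 : z = 0
    · rw [h0]; exact hn hn0
    · exact hFc z h0 hz
  have hkd' : ∀ z, ‖z‖ < 1 → AnalyticAt ℂ k z ∧ k z ≠ 0 := by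
    intro z hz
    by_cases h0 : z = 0
    · rw [h0]; exact ⟨hka, hj0 hj⟩
    · exact hkd z h0 hz
  intro ζ₁ h₁ ζ₂ h₂ heq
  have hinv : ∀ ζ ∈ exteriorDisk, ζ⁻¹ ≠ 0 ∧ ‖ζ⁻¹‖ < 1 := by
    intro ζ hζ
    have h1 : 1 < ‖ζ‖ := hζ
    refine ⟨inv_ne_zero (norm_pos_iff.1 (by linarith)), ?_⟩
    rw [norm_inv]
    exact inv_lt_one_of_one_lt₀ h1
  obtain ⟨hn₁, hl₁⟩ := hinv ζ₁ h₁
  obtain ⟨hn₂, hl₂⟩ := hinv ζ₂ h₂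
  refine inv_injective (univalent_in_disk hFc' hkd' (fun z hz => ?_) hl₁ hl₂ ?_)
  · filter_upwards [hsmall z hz, (hFc' z hz).eventually_analyticAt] with w hw hwa
    exact hcrit w hw.1 hw.2 hwa
  · rw [hFf _ hn₁, hFf _ hn₂, hFne _ hn₁, hFne _ hn₂, inv_inv, inv_inv]
    by_cases ha₁ : AnalyticAt ℂ f ζ₁ <;> by_cases ha₂ : AnalyticAt ℂ f ζ₂
    · rw [sphereValue_of_analyticAt ha₁, sphereValue_of_analyticAt ha₂] at heq
      exact Or.inl ⟨ha₁, ha₂, OnePoint.coe_injective heq⟩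
    · rw [sphereValue_of_analyticAt ha₁, sphereValue_of_not_analyticAt (hf.1 h₂) ha₂] at heq
      exact absurd heq (OnePoint.coe_ne_infty _)
    · rw [sphereValue_of_not_analyticAt (hf.1 h₁) ha₁, sphereValue_of_analyticAt ha₂] at heq
      exact absurd heq.symm (OnePoint.coe_ne_infty _)
    · exact Or.inr ⟨ha₁, ha₂⟩
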